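/- Let $m\ge n>0$ be integers, $d=\gcd(m,n)$, $m=m'd$, $n=n'd$, and let $\zeta$ be a primitive $d$-th root of unity. Let $G=\langle x,y\mid x^m=y^n\rangle$ and let $X(G)\subset\mathbb{C}^3$ be its $SL(2,\mathbb{C})$-character variety $$X(G)=\{(\operatorname{tr}\rho(x),\operatorname{tr}\rho(y),\operatorname{tr}\rho(xy)) \mid \rho:G\to SL(2,\mathbb{C}) \text{ a homomorphism}\}.$$ Define polynomials in $\mathbb{C}[T]$ by $f_0=2,\ f_1=T,\ f_k=Tf_{k-1}-f_{k-2}$; $s_0=0,\ s_1=s_2=1,\ s_3=T+1,\ s_k=Ts_{k-2}-s_{k-4}$; $\sigma_0=0,\ \sigma_1=\sigma_2=1,\ \sigma_3=T-1,\ \sigma_k=T\sigma_{k-2}-\sigma_{k-4}$; and let $g_k=\sigma_k$ if $k$ is odd, $g_k=f_{k/2}$ if $k$ is even. For integers $a,b$ let $F_{a,b}\in\mathbb{C}[X,Y,Z]$ be the unique polynomial with $F_{a,b}(\operatorname{tr}A,\operatorname{tr}B,\operatorname{tr}AB)=\operatorname{tr}(A^aB^{-b})$ for all $A,B\in SL(2,\mathbb{C})$.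 In $\mathbb{C}[X,Y,Z]$ put $$I_1=\langle s_m(X),s_n(Y)\rangle,\qquad I_2=\langle g_m(X),g_n(Y)\rangle,$$ $$I_3=\langle F_{m,n}-2,\ F_{m+1,n}-X,\ F_{m,n-1}-Y,\ X^2+Y^2+Z^2-XYZ-4\rangle .$$ For $w\in\mathbb{C}^*$ let $C_w=\{(u+u^{-1},\,v+v^{-1},\,uv+(uv)^{-1})\mid u,v\in\mathbb{C}^*,\ u^{m'}=w\,v^{n'}\}$. Then $X(G)=V(I_1)\cup V(I_2)\cup V(I_3)$. The set $V(I_1)\cup V(I_2)$ is the union of the straight lines contained in it; there are finitely many of them, and they are exactly the straight lines contained in $X(G)$. Call the set of these lines $\mathcal{L}$. Moreover $V(I_3)=\bigcup_{i=0}^{d-1}C_{\zeta^i}$, where each $C_{\zeta^i}$ is an irreducible algebraic set, $C_{\zeta^i}=C_{\zeta^j}$ (for $0\le i,j<d$) if and only if $i=j$ or $i+j=d$, and two different $C_{\zeta^i}$ are disjoint. Every line of $\mathcal{L}$ meets $V(I_3)$ in exactly two points. Say that a line meets $C$ twice if it meets $C$ in exactly two points, and that it meets the pair $\{C,C'\}$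 if it meets $C$ in exactly one point and $C'$ in exactly one other point. All indices $i,j$ below are in $\{0,\dots,d-1\}$. **(a)** Suppose that $d$ is odd. The number of lines of $\mathcal{L}$ meeting $C_1$ twice is $\frac{(m'-1)(n'-1)}{2}$; for each $i\ne0$, the number meeting $C_{\zeta^i}$ twice is $(m'-1)n'+m'(n'-1)$; for each $i\neq 0$, the number meeting $\{C_1,C_{\zeta^i}\}$ is $2m'n'$; for all $i,j\ne0$ with $C_{\zeta^i}\ne C_{\zeta^j}$, the number meeting $\{C_{\zeta^i},C_{\zeta^j}\}$ is $4m'n'$. The total number of lines is $$\tfrac{(m'-1)(n'-1)}{2}+\tfrac{d-1}{2}\big[(m'-1)n'+m'(n'-1)\big]+\tfrac{d-1}{2}\cdot 2m'n'+\tbinom{(d-1)/2}{2}\cdot 4m'n',$$ where the summands are, in order, the numbers of lines meeting $C_1$ twice, meeting some $C_{\zeta^i}$ with $i\ne0$ twice, meeting some $\{C_1,C_{\zeta^i}\}$ with $i\neq 0$, and meeting some $\{C_{\zeta^i},C_{\zeta^j}\}$ with $i,j\ne0$, $C_{\zeta^i}\neq C_{\zeta^j}$. **(b)** Suppose that $d$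 is even. The numbers of lines of $\mathcal{L}$ meeting $C_1$ twice and meeting $C_{-1}$ twice are both $\frac{(m'-1)(n'-1)}{2}$; the number meeting $\{C_1,C_{-1}\}$ is $m'n'$; for each $i\ne0,\frac d2$, the number meeting $C_{\zeta^i}$ twice is $(m'-1)n'+m'(n'-1)$, and the numbers meeting $\{C_1,C_{\zeta^i}\}$ and meeting $\{C_{-1},C_{\zeta^i}\}$ are both $2m'n'$; for all $i,j\ne0,\frac d2$ with $C_{\zeta^i}\ne C_{\zeta^j}$, the number meeting $\{C_{\zeta^i},C_{\zeta^j}\}$ is $4m'n'$. The total number of lines is $$\tfrac{(m'-1)(n'-1)}{2}+\tfrac{(m'-1)(n'-1)}{2}+\tfrac{d-2}{2}\big[(m'-1)n'+m'(n'-1)\big]+m'n'+\tfrac{d-2}{2}\cdot 2m'n'+\tfrac{d-2}{2}\cdot 2m'n'+\tbinom{(d-2)/2}{2}\cdot 4m'n',$$ where the summands are, in order, the numbers of lines meeting $C_1$ twice, $C_{-1}$ twice, some $C_{\zeta^i}$ with $i\ne0,\frac d2$ twice, $\{C_1,C_{-1}\}$, some $\{C_1,C_{\zeta^i}\}$ with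 $i\ne0,\frac d2$, some $\{C_{-1},C_{\zeta^i}\}$ with $i\ne0,\frac d2$, and some $\{C_{\zeta^i},C_{\zeta^j}\}$ with $i,j\ne0,\frac d2$, $C_{\zeta^i}\ne C_{\zeta^j}$. -/

import Mathlib

open scoped MatrixGroups

noncomputable section

namespace TorusCharVar

/-- The group `G_{m,n} = ⟨x, y ∣ x ^ m = y ^ n⟩`; `x` and `y` are the generators `0` and `1`. -/
abbrev G (m n : ℕ) : Type :=
  PresentedGroup
    ({FreeGroup.of 0 ^ m * (FreeGroup.of 1 ^ n)⁻¹} : Set (FreeGroup (Fin 2)))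

/-- The generator `x` of `G_{m,n}`. -/
def G.x (m n : ℕ) : G m n := PresentedGroup.of 0

/-- The generator `y` of `G_{m,n}`. -/
def G.y (m n : ℕ) : G m n := PresentedGroup.of 1

/-- The trace of an element of `SL(2, ℂ)`. -/
def tr (A : SL(2, ℂ)) : ℂ := Matrix.trace (A : Matrix (Fin 2) (Fin 2) ℂ)

/-- The character variety of `G_{m,n}` in `SL(2, ℂ)`, in the coordinates
`X = t_x`, `Y = t_y`, `Z = t_{xy}`. -/
def charVariety (m n : ℕ) : Set (Fin 3 → ℂ) :=
  {p | ∃ ρ : G m n →* SL(2, ℂ),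
    p = ![tr (ρ (G.x m n)), tr (ρ (G.y m n)), tr (ρ (G.x m n * G.y m n))]}

/-- `f 0 = 2`, `f 1 = T`, `f k = T * f (k - 1) - f (k - 2)`. -/
def f : ℕ → Polynomial ℂ
  | 0 => 2
  | 1 => Polynomial.X
  | k + 2 => Polynomial.X * f (k + 1) - f k

/-- `s 0 = 0`, `s 1 = s 2 = 1`, `s 3 = T + 1`, `s k = T * s (k - 2) - s (k - 4)`. -/
def s : ℕ → Polynomial ℂ
  | 0 => 0
  | 1 => 1
  | 2 => 1
  | 3 => Polynomial.X + 1
  | k + 4 => Polynomial.X * s (k + 2) - s k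

/-- `σ 0 = 0`, `σ 1 = σ 2 = 1`, `σ 3 = T - 1`, `σ k = T * σ (k - 2) - σ (k - 4)`. -/
def σ : ℕ → Polynomial ℂ
  | 0 => 0
  | 1 => 1
  | 2 => 1
  | 3 => Polynomial.X - 1
  | k + 4 => Polynomial.X * σ (k + 2) - σ k

/-- `h 0 = 0`, `h 1 = 1`, `h k = T * h (k - 1) - h (k - 2)` for all integers `k`
(Mathlib's `S` is the same family shifted by one). -/
def h (k : ℤ) : Polynomial ℂ := Polynomial.Chebyshev.S ℂ (k - 1)

/-- The one-variable polynomial `p`, written in the variable number `i` of `ℂ[X, Y, Z]`. -/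
def inVar (i : Fin 3) (p : Polynomial ℂ) : MvPolynomial (Fin 3) ℂ :=
  Polynomial.aeval (MvPolynomial.X i) p

/-- The trace polynomial `F_{a,b}(X, Y, Z)`: the only polynomial with
`F_{a,b}(tr A, tr B, tr AB) = tr (A ^ a * B ^ (-b))` for all `A, B ∈ SL(2, ℂ)`
(see `eval_F`). -/
def F (a b : ℤ) : MvPolynomial (Fin 3) ℂ :=
  inVar 0 (h a) * inVar 1 (h b) *
      (MvPolynomial.X 0 * MvPolynomial.X 1 - MvPolynomial.X 2)
    - inVar 0 (h a) * inVar 1 (h (b - 1)) * MvPolynomial.X 0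
    - inVar 0 (h (a - 1)) * inVar 1 (h b) * MvPolynomial.X 1
    + 2 * inVar 0 (h (a - 1)) * inVar 1 (h (b - 1))

/-- `D = X ^ 2 + Y ^ 2 + Z ^ 2 - X Y Z - 4`. -/
def D : MvPolynomial (Fin 3) ℂ :=
  MvPolynomial.X 0 ^ 2 + MvPolynomial.X 1 ^ 2 + MvPolynomial.X 2 ^ 2
    - MvPolynomial.X 0 * MvPolynomial.X 1 * MvPolynomial.X 2 - 4

/-- The ideal `J` of `X(G_{m,n})`. -/
def J (m n : ℕ) : Ideal (MvPolynomial (Fin 3) ℂ) :=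
  Ideal.span {F m n - 2, F (m + 1) n - MvPolynomial.X 0, F m (n - 1) - MvPolynomial.X 1}

def I₁ (m n : ℕ) : Ideal (MvPolynomial (Fin 3) ℂ) :=
  Ideal.span {inVar 0 (s m), inVar 1 (s n)}

open Classical in
/-- `σ_k` if `k` is odd and `f_{k/2}` if `k` is even. -/
def g (k : ℕ) : Polynomial ℂ := if Odd k then σ k else f (k / 2)

def I₂ (m n : ℕ) : Ideal (MvPolynomial (Fin 3) ℂ) :=
  Ideal.span {inVar 0 (g m), inVar 1 (g n)}

def I₃ (m n : ℕ) : Ideal (MvPolynomial (Fin 3) ℂ) := J m n ⊔ Ideal.span {D}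

/-- The zero set in `ℂ³` of an ideal of `ℂ[X, Y, Z]`. -/
def V (I : Ideal (MvPolynomial (Fin 3) ℂ)) : Set (Fin 3 → ℂ) := MvPolynomial.zeroLocus ℂ I

/-- The curve `C_w`, for a `d`-th root of unity `w`, where `m'` and `n'` are the
quotients of `m` and `n` by `d = gcd(m, n)`. -/
def C (m' n' : ℕ) (w : ℂ) : Set (Fin 3 → ℂ) :=
  {p | ∃ u v : ℂ, u ≠ 0 ∧ v ≠ 0 ∧ u ^ m' = w * v ^ n' ∧
    p = ![u + u⁻¹, v + v⁻¹, u * v + (u * v)⁻¹]}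

/-- Irreducible algebraic subsets of `ℂ³`. -/
def IsIrreducibleAlgebraic (K : Set (Fin 3 → ℂ)) : Prop :=
  V (MvPolynomial.vanishingIdeal ℂ K) = K ∧ (MvPolynomial.vanishingIdeal ℂ K).IsPrime

/-- Straight lines in `ℂ³`. -/
def IsStraightLine (L : Set (Fin 3 → ℂ)) : Prop :=
  ∃ p v : Fin 3 → ℂ, v ≠ 0 ∧ L = Set.range fun t : ℂ => p + t • v

/-- The straight lines of `X(G_{m,n})`, that is, those of `V(I₁) ∪ V(I₂)`. -/
def lines (m n : ℕ) : Set (Set (Fin 3 → ℂ)) :=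
  {L | IsStraightLine L ∧ L ⊆ V (I₁ m n) ∪ V (I₂ m n)}

/-- `L` intersects `K` twice, i.e. in exactly two points. -/
def MeetsTwice (L K : Set (Fin 3 → ℂ)) : Prop := (L ∩ K).ncard = 2

/-- `L` intersects the pair `{K, K'}`: it intersects each of `K` and `K'` in exactly one point,
and these two points are different. -/
def MeetsPair (L K K' : Set (Fin 3 → ℂ)) : Prop :=
  ∃ P Q : Fin 3 → ℂ, P ≠ Q ∧ L ∩ K = {P} ∧ L ∩ K' = {Q}

/-! Check of the trace polynomial. -/

theorem h_add_one (k : ℤ) : h (k + 1) = Polynomial.X * h k - h (k - 1) := by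
  have := Polynomial.Chebyshev.S_add_one ℂ (k - 1)
  simp only [h]
  convert this using 2
  ring

theorem sl_sq (A : SL(2, ℂ)) : (A : Matrix (Fin 2) (Fin 2) ℂ) * A =
    tr A • (A : Matrix (Fin 2) (Fin 2) ℂ) - 1 := by
  have hd := A.det_coe
  rw [Matrix.det_fin_two] at hd
  ext i j
  fin_cases i <;> fin_cases j <;>
    simp [Matrix.mul_apply, Fin.sum_univ_two, tr, Matrix.trace_fin_two]
  · linear_combination -hd
  · ring
  · ring
  · linear_combination -hd

theorem sl_inv (A : SL(2, ℂ)) : ((A⁻¹ : SL(2, ℂ)) : Matrix (Fin 2) (Fin 2) ℂ) =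
    tr A • 1 - (A : Matrix (Fin 2) (Fin 2) ℂ) := by
  rw [Matrix.SpecialLinearGroup.coe_inv, Matrix.adjugate_fin_two]
  ext i j
  fin_cases i <;> fin_cases j <;> simp [tr, Matrix.trace_fin_two]

theorem sl_zpow (A : SL(2, ℂ)) (k : ℤ) :
    ((A ^ k : SL(2, ℂ)) : Matrix (Fin 2) (Fin 2) ℂ) =
      (h k).eval (tr A) • (A : Matrix (Fin 2) (Fin 2) ℂ) -
        ((h (k - 1)).eval (tr A)) • 1 := by
  induction k using Int.induction_on with
  | zero => simp [h, Polynomial.Chebyshev.S_neg_two]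
  | succ k ih =>
    rw [zpow_add_one, Matrix.SpecialLinearGroup.coe_mul, ih, h_add_one, sub_mul, smul_mul_assoc,
      sl_sq, add_sub_cancel_right]
    simp only [Polynomial.eval_sub, Polynomial.eval_mul, Polynomial.eval_X, smul_mul_assoc, one_mul]
    module
  | pred k ih =>
    have e := h_add_one (-(k : ℤ) - 1)
    rw [sub_add_cancel] at e
    rw [zpow_sub_one, Matrix.SpecialLinearGroup.coe_mul, ih, sl_inv, e]
    simp only [Polynomial.eval_sub, Polynomial.eval_mul, Polynomial.eval_X, mul_sub, sub_mul,
      smul_mul_assoc, one_mul, mul_smul_comm, mul_one, sl_sq]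
    module

theorem eval_inVar (i : Fin 3) (p : Polynomial ℂ) (x : Fin 3 → ℂ) :
    MvPolynomial.eval x (inVar i p) = p.eval (x i) := by
  simp [inVar, Polynomial.aeval_def, Polynomial.eval₂_eq_sum_range, Polynomial.eval_eq_sum_range]

theorem eval_F (a b : ℤ) (A B : SL(2, ℂ)) :
    MvPolynomial.eval ![tr A, tr B, tr (A * B)] (F a b) =
      tr (A ^ a * B ^ (-b)) := by
  have e1 : h (-b) = -h b := by
    have := Polynomial.Chebyshev.S_neg_sub_one ℂ b
    simpa [h] using this
  have e2 : h (-b - 1) = -(Polynomial.X * h b - h (b - 1)) := by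
    rw [← h_add_one]
    have := Polynomial.Chebyshev.S_neg_sub_two ℂ b
    simp only [h]
    convert this using 2
    · ring
    · simp
  have e3 : tr (A ^ a * B ^ (-b)) =
      (((h a).eval (tr A) • (A : Matrix (Fin 2) (Fin 2) ℂ) - ((h (a - 1)).eval (tr A)) • 1) *
        ((h (-b)).eval (tr B) • (B : Matrix (Fin 2) (Fin 2) ℂ) -
          ((h (-b - 1)).eval (tr B)) • 1)).trace := by
    rw [← sl_zpow, ← sl_zpow, tr, Matrix.SpecialLinearGroup.coe_mul]
  rw [e3, e1, e2]
  simp only [F, map_add, map_sub, map_mul, eval_inVar, MvPolynomial.eval_X, map_ofNat]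
  simp [sub_mul, mul_sub, Matrix.trace_sub, Matrix.trace_smul, ← tr.eq_1,
    ← Matrix.SpecialLinearGroup.coe_mul]
  ring

end TorusCharVar

end

/-! Everything is expressed through eigenvalues. The surface `D = 0` is the image of `(u, v) ↦ pt u
v`, and on it `F a b` takes the value z + z⁻¹ with z = u^a v^(-b). So `V (I₃ m n)` is the image of
u^m = v^n, which splits according to the d-th root of unity u^m' v^(-n'). Each C_w is the locus
F_{m',n'} = w + w⁻¹ inside `D = 0`, so w matters only up to inversion and different curves are
disjoint. As m' and n' are coprime, each curve is parametrised by ℂ* and hence irreducible.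

If `D` does not vanish at the traces of A and B, the matrices do not commute, whereas A^m = B^n
commutes with both. By Cayley–Hamilton A^m and B^n are then scalar, and the eigenvalues satisfy u^m
= v^n = ±1 with u, v ≠ ±1; these are the zeros of `I₁` (sign +) and `I₂` (sign −). The trace of AB
stays free, which gives vertical lines (`charVariety_eq`). Any line has only finitely many points in
`V (I₃ m n)`, so a line in the character variety must be one of these (`IsStraightLine.eq_lineOf`).

The line of (u, v) meets `D = 0` in `pt u v` and `pt u v⁻¹`, which lie on C_a and C_b for a = u^m'
v^(-n') and b = u^m' v^n'. Its type is thus read off from (a, b). For given d-th roots of unity a, b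
there are 2(m' − [ab = 1])(n' − [a = b]) pairs (u, v) (`ncard_pairs_fiber`), and each line comes
from four pairs. `two_mul_ncard_lines` turns every count into a sum of these numbers over pairs of
exponents. -/

noncomputable section

namespace TorusCharVar

/-! ### Parametrisation of the surface `D = 0` -/

/-- The point of `D = 0` given by the pair of diagonal matrices with eigenvalues `u` and `v`. -/
def pt (u v : ℂ) : Fin 3 → ℂ := ![u + u⁻¹, v + v⁻¹, u * v + (u * v)⁻¹]

@[simp] theorem pt_zero (u v : ℂ) : pt u v 0 = u + u⁻¹ := rfl

@[simp] theorem pt_one (u v : ℂ) : pt u v 1 = v + v⁻¹ := rfl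

@[simp] theorem pt_two (u v : ℂ) : pt u v 2 = u * v + (u * v)⁻¹ := rfl

theorem exists_add_inv (a : ℂ) : ∃ u : ℂ, u ≠ 0 ∧ a = u + u⁻¹ := by
  obtain ⟨u, hu⟩ := exists_quadratic_eq_zero (a := (1 : ℂ)) (b := -a) (c := 1) one_ne_zero
    (by
      obtain ⟨z, hz⟩ := IsAlgClosed.exists_pow_nat_eq (discrim 1 (-a) 1) (n := 2) (by norm_num)
      exact ⟨z, by rw [← hz, sq]⟩)
  have h0 : u ≠ 0 := by
    rintro rfl
    simp at hu
  refine ⟨u, h0, ?_⟩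
  field_simp
  linear_combination -hu

theorem add_inv_eq_add_inv_iff {u v : ℂ} (hu : u ≠ 0) (hv : v ≠ 0) :
    u + u⁻¹ = v + v⁻¹ ↔ u = v ∨ u = v⁻¹ := by
  constructor
  · intro e
    have : (u - v) * (u * v - 1) = 0 := by
      field_simp at e
      linear_combination e
    rcases mul_eq_zero.1 this with e | e
    · exact .inl (sub_eq_zero.1 e)
    · exact .inr (eq_inv_of_mul_eq_one_left (sub_eq_zero.1 e))
  · rintro (rfl | rfl)
    · rfl
    · rw [inv_inv, add_comm]

theorem add_inv_eq_two_iff {u : ℂ} (hu : u ≠ 0) : u + u⁻¹ = 2 ↔ u = 1 := by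
  have := add_inv_eq_add_inv_iff hu one_ne_zero
  norm_num at this
  exact this

theorem eval_D (p : Fin 3 → ℂ) :
    MvPolynomial.eval p D = p 0 ^ 2 + p 1 ^ 2 + p 2 ^ 2 - p 0 * p 1 * p 2 - 4 := by
  simp [D]

theorem eval_D_pt {u v : ℂ} (hu : u ≠ 0) (hv : v ≠ 0) : MvPolynomial.eval (pt u v) D = 0 := by
  rw [eval_D, pt_zero, pt_one, pt_two]
  field_simp
  ring

/-- With the first two coordinates fixed, `D` is a monic quadratic in the third, with roots uv +
(uv)⁻¹ and uv⁻¹ + (uv⁻¹)⁻¹. -/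
theorem eq_pt_or_of_eval_D {u v : ℂ} (hu : u ≠ 0) (hv : v ≠ 0) {p : Fin 3 → ℂ}
    (h0 : p 0 = u + u⁻¹) (h1 : p 1 = v + v⁻¹) (hD : MvPolynomial.eval p D = 0) :
    p = pt u v ∨ p = pt u v⁻¹ := by
  have : (p 2 - (u * v + (u * v)⁻¹)) * (p 2 - (u * v⁻¹ + (u * v⁻¹)⁻¹)) = 0 := by
    rw [eval_D, h0, h1] at hD
    rw [← hD]
    field_simp
    ring
  rcases mul_eq_zero.1 this with e | e
  · left
    ext i
    fin_cases i
    exacts [h0, h1, sub_eq_zero.1 e]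
  · right
    ext i
    fin_cases i
    exacts [h0, by simp [h1, add_comm], sub_eq_zero.1 e]

theorem exists_eq_pt {p : Fin 3 → ℂ} (hD : MvPolynomial.eval p D = 0) :
    ∃ u v : ℂ, u ≠ 0 ∧ v ≠ 0 ∧ p = pt u v := by
  obtain ⟨u, hu, h0⟩ := exists_add_inv (p 0)
  obtain ⟨v, hv, h1⟩ := exists_add_inv (p 1)
  rcases eq_pt_or_of_eval_D hu hv h0 h1 hD with e | e
  · exact ⟨u, v, hu, hv, e⟩
  · exact ⟨u, v⁻¹, hu, inv_ne_zero hv, e⟩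

theorem pt_inv_inv (u v : ℂ) : pt u⁻¹ v⁻¹ = pt u v := by
  ext i
  fin_cases i <;> simp [pt, add_comm, mul_comm]

/-- Diagonal matrices of determinant one. -/
def diagSL : ℂˣ →* SL(2, ℂ) where
  toFun u := ⟨!![(u : ℂ), 0; 0, ((u⁻¹ : ℂˣ) : ℂ)], by simp [Matrix.det_fin_two]⟩
  map_one' := by
    ext i j
    fin_cases i <;> fin_cases j <;> simp
  map_mul' u v := by
    apply Subtype.ext
    change !![((u * v : ℂˣ) : ℂ), 0; 0, (((u * v)⁻¹ : ℂˣ) : ℂ)] =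
      !![(u : ℂ), 0; 0, ((u⁻¹ : ℂˣ) : ℂ)] * !![(v : ℂ), 0; 0, ((v⁻¹ : ℂˣ) : ℂ)]
    rw [Matrix.mul_fin_two]
    simp [mul_comm]

theorem coe_diagSL (u : ℂˣ) : (diagSL u : Matrix (Fin 2) (Fin 2) ℂ) =
    !![(u : ℂ), 0; 0, ((u⁻¹ : ℂˣ) : ℂ)] := rfl

theorem tr_diagSL (u : ℂˣ) : tr (diagSL u) = u + (u : ℂ)⁻¹ := by
  simp [tr, coe_diagSL, Matrix.trace_fin_two]

/-- This is `eval_F` for the diagonal matrices with eigenvalues u and v. -/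
theorem eval_F_pt (a b : ℤ) {u v : ℂ} (hu : u ≠ 0) (hv : v ≠ 0) :
    MvPolynomial.eval (pt u v) (F a b) = u ^ a * v ^ (-b) + (u ^ a * v ^ (-b))⁻¹ := by
  have := eval_F a b (diagSL (Units.mk0 u hu)) (diagSL (Units.mk0 v hv))
  rw [← map_zpow, ← map_zpow, ← map_mul, ← map_mul] at this
  simp only [tr_diagSL] at this
  simpa [pt] using this

theorem zpow_eq_eval_h {u : ℂ} (hu : u ≠ 0) (k : ℤ) :
    u ^ k = (h k).eval (u + u⁻¹) * u - (h (k - 1)).eval (u + u⁻¹) := by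
  have := congrFun (congrFun (sl_zpow (diagSL (Units.mk0 u hu)) k) 0) 0
  rw [← map_zpow, tr_diagSL, coe_diagSL, coe_diagSL] at this
  simpa using this

theorem mem_V_span (S : Set (MvPolynomial (Fin 3) ℂ)) (p : Fin 3 → ℂ) :
    p ∈ V (Ideal.span S) ↔ ∀ q ∈ S, MvPolynomial.eval p q = 0 := by
  rw [V, MvPolynomial.zeroLocus_span]
  simp [MvPolynomial.aeval_eq_eval]

theorem mem_V_I₃ (m n : ℕ) (p : Fin 3 → ℂ) :
    p ∈ V (I₃ m n) ↔ MvPolynomial.eval p (F m n) = 2 ∧ MvPolynomial.eval p (F (m + 1) n) = p 0 ∧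
      MvPolynomial.eval p (F m (n - 1)) = p 1 ∧ MvPolynomial.eval p D = 0 := by
  rw [I₃, J, ← Ideal.span_union, mem_V_span]
  simp [sub_eq_zero, or_imp, forall_and]
  exact ⟨fun ⟨h1, h2, h3, h4⟩ => ⟨h2, h3, h4, h1⟩, fun ⟨h2, h3, h4, h1⟩ => ⟨h1, h2, h3, h4⟩⟩

/-- On `D = 0` the first generator alone forces z = u^m v^(-n) = 1, because z + z⁻¹ = 2 has the
single solution 1; the other two generators then vanish automatically. -/
theorem mem_V_I₃_iff_exists (m n : ℕ) (p : Fin 3 → ℂ) :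
    p ∈ V (I₃ m n) ↔ ∃ u v : ℂ, u ≠ 0 ∧ v ≠ 0 ∧ u ^ m = v ^ n ∧ p = pt u v := by
  rw [mem_V_I₃]
  constructor
  · rintro ⟨h1, -, -, hD⟩
    obtain ⟨u, v, hu, hv, rfl⟩ := exists_eq_pt hD
    refine ⟨u, v, hu, hv, ?_, rfl⟩
    rw [eval_F_pt _ _ hu hv, add_inv_eq_two_iff (by positivity)] at h1
    rw [zpow_neg, zpow_natCast, zpow_natCast] at h1
    exact (mul_inv_eq_one₀ (pow_ne_zero _ hv)).1 h1
  · rintro ⟨u, v, hu, hv, e, rfl⟩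
    have e' : u ^ (m : ℤ) * v ^ (-(n : ℤ)) = 1 := by
      rw [zpow_neg, zpow_natCast, zpow_natCast, e, mul_inv_cancel₀ (pow_ne_zero _ hv)]
    refine ⟨?_, ?_, ?_, eval_D_pt hu hv⟩
    · rw [eval_F_pt _ _ hu hv, e']
      norm_num
    · rw [eval_F_pt _ _ hu hv, zpow_add₀ hu, mul_right_comm, e']
      simp
    · rw [eval_F_pt _ _ hu hv, neg_sub, sub_eq_add_neg, zpow_add₀ hv, mul_left_comm, e']
      simp

/-- The value w + w⁻¹ determines w up to inversion, and the ambiguity is harmless: inverting u and v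
together does not move `pt u v`. -/
theorem mem_C_iff {m' n' : ℕ} {w : ℂ} (hw : w ≠ 0) (p : Fin 3 → ℂ) :
    p ∈ C m' n' w ↔ MvPolynomial.eval p (F m' n') = w + w⁻¹ ∧ MvPolynomial.eval p D = 0 := by
  have key {u v : ℂ} (hu : u ≠ 0) (hv : v ≠ 0) :
      MvPolynomial.eval (pt u v) (F m' n') = w + w⁻¹ ↔
        u ^ m' = w * v ^ n' ∨ u⁻¹ ^ m' = w * v⁻¹ ^ n' := by
    rw [eval_F_pt _ _ hu hv, add_inv_eq_add_inv_iff (by positivity) hw, zpow_neg, zpow_natCast,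
      zpow_natCast]
    have h1 : u ^ m' ≠ 0 := pow_ne_zero _ hu
    have h2 : v ^ n' ≠ 0 := pow_ne_zero _ hv
    rw [inv_pow, inv_pow]
    field_simp
    rw [eq_comm (a := v ^ n')]
  constructor
  · rintro ⟨u, v, hu, hv, e, rfl⟩
    exact ⟨(key hu hv).2 (.inl e), eval_D_pt hu hv⟩
  · rintro ⟨hF, hD⟩
    obtain ⟨u, v, hu, hv, rfl⟩ := exists_eq_pt hD
    rcases (key hu hv).1 hF with e | e
    · exact ⟨u, v, hu, hv, e, rfl⟩
    · exact ⟨u⁻¹, v⁻¹, inv_ne_zero hu, inv_ne_zero hv, e, (pt_inv_inv u v).symm⟩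

theorem C_nonempty {m' n' : ℕ} (hm' : 0 < m') {w : ℂ} (hw : w ≠ 0) : (C m' n' w).Nonempty := by
  obtain ⟨u, hu⟩ := IsAlgClosed.exists_pow_nat_eq w hm'
  refine ⟨pt u 1, u, 1, ?_, one_ne_zero, by simpa using hu, rfl⟩
  rintro rfl
  rw [zero_pow hm'.ne'] at hu
  exact hw hu.symm

theorem C_eq_iff {m' n' : ℕ} (hm' : 0 < m') {w z : ℂ} (hw : w ≠ 0) (hz : z ≠ 0) :
    C m' n' w = C m' n' z ↔ w = z ∨ w = z⁻¹ := by
  rw [← add_inv_eq_add_inv_iff hw hz]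
  constructor
  · intro e
    obtain ⟨p, hp⟩ := C_nonempty (n' := n') hm' hw
    have hp' := hp
    rw [e, mem_C_iff hz] at hp'
    rw [mem_C_iff hw] at hp
    rw [← hp.1, ← hp'.1]
  · intro e
    ext p
    rw [mem_C_iff hw, mem_C_iff hz, e]

theorem disjoint_C {m' n' : ℕ} {w z : ℂ} (hw : w ≠ 0) (hz : z ≠ 0)
    (hne : C m' n' w ≠ C m' n' z) : Disjoint (C m' n' w) (C m' n' z) := by
  rw [Set.disjoint_left]
  intro p hp hp'
  rw [mem_C_iff hw] at hp
  rw [mem_C_iff hz] at hp'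
  apply hne
  ext q
  rw [mem_C_iff hw, mem_C_iff hz, ← hp.1, ← hp'.1]

theorem V_I₃_eq_iUnion {d m' n' : ℕ} (hd : 0 < d) {ζ : ℂ} (hζ : IsPrimitiveRoot ζ d) :
    V (I₃ (m' * d) (n' * d)) = ⋃ i ∈ Finset.range d, C m' n' (ζ ^ i) := by
  have : NeZero d := ⟨hd.ne'⟩
  ext p
  simp only [mem_V_I₃_iff_exists, Set.mem_iUnion, Finset.mem_range, exists_prop]
  constructor
  · rintro ⟨u, v, hu, hv, e, rfl⟩
    obtain ⟨i, hi, e'⟩ := hζ.eq_pow_of_pow_eq_one (ξ := u ^ m' * (v ^ n')⁻¹) (by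
      rw [mul_pow, inv_pow, ← pow_mul, ← pow_mul, e, mul_inv_cancel₀ (by positivity)])
    refine ⟨i, hi, u, v, hu, hv, ?_, rfl⟩
    rw [e', inv_mul_cancel_right₀ (by positivity)]
  · rintro ⟨i, hi, u, v, hu, hv, e, rfl⟩
    refine ⟨u, v, hu, hv, ?_, rfl⟩
    rw [pow_mul, e, mul_pow, ← pow_mul, ← pow_mul, mul_comm i d, pow_mul, hζ.pow_eq_one, one_pow,
      one_mul]

/-! ### Irreducibility of the curves -/

/-- Each coordinate is a Laurent polynomial in t, so a power of t clears the denominators. This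
transfers products of functions on the curve to the integral domain ℂ[t]. -/
theorem exists_pow_mul_eval_eq (c : ℂ) (hc : c ≠ 0) (a b : ℕ) (p : MvPolynomial (Fin 3) ℂ) :
    ∃ (N : ℕ) (P : Polynomial ℂ), ∀ t : ℂ, t ≠ 0 →
      t ^ N * MvPolynomial.eval (pt (t ^ a) (c * t ^ b)) p = P.eval t := by
  induction p using MvPolynomial.induction_on with
  | C z => exact ⟨0, Polynomial.C z, fun t _ => by simp⟩
  | add p q hp hq =>
    obtain ⟨N, P, hP⟩ := hp
    obtain ⟨M, Q, hQ⟩ := hq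
    refine ⟨N + M, Polynomial.X ^ M * P + Polynomial.X ^ N * Q, fun t ht => ?_⟩
    simp only [map_add, Polynomial.eval_add, Polynomial.eval_mul, Polynomial.eval_pow,
      Polynomial.eval_X, ← hP t ht, ← hQ t ht]
    ring
  | mul_X p i hp =>
    obtain ⟨N, P, hP⟩ := hp
    obtain ⟨M, Q, hQ⟩ : ∃ (M : ℕ) (Q : Polynomial ℂ), ∀ t : ℂ, t ≠ 0 →
        t ^ M * pt (t ^ a) (c * t ^ b) i = Q.eval t := by
      fin_cases i
      · refine ⟨a, Polynomial.X ^ (2 * a) + 1, fun t ht => ?_⟩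
        simp
        field_simp
        ring
      · refine ⟨b, Polynomial.C c * Polynomial.X ^ (2 * b) + Polynomial.C c⁻¹, fun t ht => ?_⟩
        simp
        field_simp
        ring
      · refine ⟨a + b, Polynomial.C c * Polynomial.X ^ (2 * (a + b)) + Polynomial.C c⁻¹,
          fun t ht => ?_⟩
        simp
        field_simp
        ring
    refine ⟨N + M, P * Q, fun t ht => ?_⟩
    rw [Polynomial.eval_mul, ← hP t ht, ← hQ t ht, map_mul, MvPolynomial.eval_X]
    ring

/-- After the scaling v' = c⁻¹v the equation reads u^m' = v'^n'. With Bézout coefficients m'x + n'y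
= 1, the parameter t = u^y v'^x satisfies t^n' = u and t^m' = v'. -/
theorem C_eq_image {m' n' : ℕ} (hcop : m'.Coprime n') {c : ℂ} (hc : c ≠ 0) :
    C m' n' (c ^ n')⁻¹ = (fun t => pt (t ^ n') (c * t ^ m')) '' {t | t ≠ 0} := by
  ext p
  constructor
  · rintro ⟨u, v, hu, hv, e, rfl⟩
    set v' := c⁻¹ * v with hv'
    have hv0 : v' ≠ 0 := mul_ne_zero (inv_ne_zero hc) hv
    have e' : u ^ m' = v' ^ n' := by
      rw [e, hv', mul_pow, inv_pow]
    have bez : (m' : ℤ) * m'.gcdA n' + n' * m'.gcdB n' = 1 := by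
      rw [← Nat.gcd_eq_gcd_ab, hcop.gcd_eq_one]
      rfl
    set x := m'.gcdA n'
    set y := m'.gcdB n'
    have e2 : u ^ (m' : ℤ) = v' ^ (n' : ℤ) := by exact_mod_cast e'
    refine ⟨u ^ y * v' ^ x, mul_ne_zero (zpow_ne_zero _ hu) (zpow_ne_zero _ hv0), ?_⟩
    have hU : (u ^ y * v' ^ x) ^ n' = u := by
      rw [← zpow_natCast, mul_zpow, ← zpow_mul, ← zpow_mul, mul_comm x, zpow_mul v', ← e2,
        ← zpow_mul, ← zpow_add₀ hu]
      rw [show y * (n' : ℤ) + m' * x = 1 by linarith, zpow_one]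
    have hW : (u ^ y * v' ^ x) ^ m' = v' := by
      rw [← zpow_natCast, mul_zpow, ← zpow_mul, ← zpow_mul, mul_comm y, zpow_mul u, e2,
        ← zpow_mul, ← zpow_add₀ hv0]
      rw [show n' * y + x * (m' : ℤ) = 1 by linarith, zpow_one]
    simp only [hU, hW]
    rw [hv', mul_inv_cancel_left₀ hc]
    rfl
  · rintro ⟨t, ht, rfl⟩
    refine ⟨t ^ n', c * t ^ m', pow_ne_zero _ ht, mul_ne_zero hc (pow_ne_zero _ ht), ?_, rfl⟩
    rw [mul_pow, inv_mul_cancel_left₀ (pow_ne_zero _ hc), ← pow_mul, ← pow_mul, mul_comm]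

/-- The curve is closed because `mem_C_iff` gives equations for it. Its ideal is prime because,
along the parametrisation, a vanishing product yields a polynomial in t with infinitely many roots,
so one factor is zero. -/
theorem isIrreducibleAlgebraic_C {m' n' : ℕ} (hcop : m'.Coprime n') (hn' : 0 < n')
    {w : ℂ} (hw : w ≠ 0) : IsIrreducibleAlgebraic (C m' n' w) := by
  refine ⟨Set.Subset.antisymm ?_ (MvPolynomial.zeroLocus_vanishingIdeal_le _), ?_⟩
  · intro p hp
    have hp' (q : MvPolynomial (Fin 3) ℂ) (hq : ∀ x ∈ C m' n' w, MvPolynomial.eval x q = 0) :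
        MvPolynomial.eval p q = 0 := by
      have := hp q (by simpa [MvPolynomial.aeval_eq_eval] using hq)
      simpa [MvPolynomial.aeval_eq_eval] using this
    rw [mem_C_iff hw]
    constructor
    · have := hp' (F m' n' - MvPolynomial.C (w + w⁻¹)) (fun x hx => by
        rw [map_sub, MvPolynomial.eval_C, ((mem_C_iff hw x).1 hx).1, sub_self])
      rwa [map_sub, MvPolynomial.eval_C, sub_eq_zero] at this
    · exact hp' D fun x hx => ((mem_C_iff hw x).1 hx).2
  · obtain ⟨c, hc⟩ := IsAlgClosed.exists_pow_nat_eq w⁻¹ hn'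
    have hc0 : c ≠ 0 := by
      rintro rfl
      rw [zero_pow hn'.ne'] at hc
      exact inv_ne_zero hw hc.symm
    have hC := C_eq_image hcop hc0
    rw [hc, inv_inv] at hC
    have key (p : MvPolynomial (Fin 3) ℂ) : p ∈ MvPolynomial.vanishingIdeal ℂ (C m' n' w) ↔
        ∀ t : ℂ, t ≠ 0 → MvPolynomial.eval (pt (t ^ n') (c * t ^ m')) p = 0 := by
      rw [hC]
      simp [MvPolynomial.aeval_eq_eval]
    refine ⟨?_, fun {p q} hpq => ?_⟩
    · rw [Ideal.ne_top_iff_one, key]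
      intro hcon
      simpa using hcon 1 one_ne_zero
    · rw [key] at hpq ⊢
      rw [key]
      obtain ⟨N, P, hP⟩ := exists_pow_mul_eval_eq c hc0 n' m' p
      obtain ⟨M, Q, hQ⟩ := exists_pow_mul_eval_eq c hc0 n' m' q
      have hPQ : P * Q = 0 := by
        refine Polynomial.eq_zero_of_infinite_isRoot _ ((Set.infinite_of_finite_compl
          (s := {t : ℂ | t ≠ 0}) (by simp [Set.compl_ne_eq_singleton])).mono fun t ht => ?_)
        have := hpq t ht
        rw [map_mul] at this
        rw [Set.mem_ofPred_eq, Polynomial.IsRoot, Polynomial.eval_mul, ← hP t ht, ← hQ t ht]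
        linear_combination t ^ N * t ^ M * this
      rcases mul_eq_zero.1 hPQ with h0 | h0
      · left
        intro t ht
        have := hP t ht
        rw [h0, Polynomial.eval_zero] at this
        exact (mul_eq_zero.1 this).resolve_left (pow_ne_zero _ ht)
      · right
        intro t ht
        have := hQ t ht
        rw [h0, Polynomial.eval_zero] at this
        exact (mul_eq_zero.1 this).resolve_left (pow_ne_zero _ ht)

/-! ### Roots of the one-variable polynomials -/

theorem s_add_four (k : ℕ) : s (k + 4) = Polynomial.X * s (k + 2) - s k := by rw [s]

theorem σ_add_four (k : ℕ) : σ (k + 4) = Polynomial.X * σ (k + 2) - σ k := by rw [σ]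

/-- The factor u − u⁻¹ is kept on the left, so the identity is empty at u = ±1; the values there are
computed separately from the recurrence. The same holds for odd indices at u = 1, and for `σ` at u =
−1. -/
theorem eval_s_even {u : ℂ} (hu : u ≠ 0) (j : ℕ) :
    (s (2 * j)).eval (u + u⁻¹) * (u - u⁻¹) = u ^ j - u⁻¹ ^ j := by
  induction j using Nat.twoStepInduction with
  | zero => simp [s]
  | one => simp [s]
  | more j h0 h1 =>
    rw [show 2 * (j + 2) = 2 * j + 4 by ring, s_add_four, show 2 * j + 2 = 2 * (j + 1) by ring,
      Polynomial.eval_sub, Polynomial.eval_mul, Polynomial.eval_X]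
    have e : u * u⁻¹ = 1 := mul_inv_cancel₀ hu
    linear_combination (u + u⁻¹) * h1 - h0 + (u ^ j - u⁻¹ ^ j) * e

theorem eval_s_odd {u : ℂ} (hu : u ≠ 0) (j : ℕ) :
    (s (2 * j + 1)).eval (u + u⁻¹) * (u - 1) * u ^ j = u ^ (2 * j + 1) - 1 := by
  induction j using Nat.twoStepInduction with
  | zero => simp [s]
  | one =>
    simp [s]
    field_simp
    ring
  | more j h0 h1 =>
    rw [show 2 * (j + 2) + 1 = 2 * j + 1 + 4 by ring, s_add_four,
      show 2 * j + 1 + 2 = 2 * (j + 1) + 1 by ring,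
      Polynomial.eval_sub, Polynomial.eval_mul, Polynomial.eval_X]
    have e : u * u⁻¹ = 1 := mul_inv_cancel₀ hu
    linear_combination (u + u⁻¹) * u * h1 - u ^ 2 * h0 + (u ^ (2 * j + 3) - 1) * e

theorem eval_s_even_two (j : ℕ) : (s (2 * j)).eval 2 = j := by
  induction j using Nat.twoStepInduction with
  | zero => simp [s]
  | one => simp [s]
  | more j h0 h1 =>
    rw [show 2 * (j + 2) = 2 * j + 4 by ring, s_add_four, show 2 * j + 2 = 2 * (j + 1) by ring,
      Polynomial.eval_sub, Polynomial.eval_mul, Polynomial.eval_X, h0, h1]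
    push_cast
    ring

theorem eval_s_even_neg_two (j : ℕ) : (s (2 * j)).eval (-2) = -(-1) ^ j * j := by
  induction j using Nat.twoStepInduction with
  | zero => simp [s]
  | one => simp [s]
  | more j h0 h1 =>
    rw [show 2 * (j + 2) = 2 * j + 4 by ring, s_add_four, show 2 * j + 2 = 2 * (j + 1) by ring,
      Polynomial.eval_sub, Polynomial.eval_mul, Polynomial.eval_X, h0, h1]
    push_cast
    ring

theorem eval_s_odd_two (j : ℕ) : (s (2 * j + 1)).eval 2 = 2 * j + 1 := by
  induction j using Nat.twoStepInduction with
  | zero => simp [s]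
  | one => simp [s]
  | more j h0 h1 =>
    rw [show 2 * (j + 2) + 1 = 2 * j + 1 + 4 by ring, s_add_four,
      show 2 * j + 1 + 2 = 2 * (j + 1) + 1 by ring,
      Polynomial.eval_sub, Polynomial.eval_mul, Polynomial.eval_X, h0, h1]
    push_cast
    ring

theorem eval_σ_odd {u : ℂ} (hu : u ≠ 0) (j : ℕ) :
    (σ (2 * j + 1)).eval (u + u⁻¹) * (u + 1) * u ^ j = u ^ (2 * j + 1) + 1 := by
  induction j using Nat.twoStepInduction with
  | zero => simp [σ]
  | one =>
    simp [σ]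
    field_simp
    ring
  | more j h0 h1 =>
    rw [show 2 * (j + 2) + 1 = 2 * j + 1 + 4 by ring, σ_add_four,
      show 2 * j + 1 + 2 = 2 * (j + 1) + 1 by ring,
      Polynomial.eval_sub, Polynomial.eval_mul, Polynomial.eval_X]
    have e : u * u⁻¹ = 1 := mul_inv_cancel₀ hu
    linear_combination (u + u⁻¹) * u * h1 - u ^ 2 * h0 + (u ^ (2 * j + 3) + 1) * e

theorem eval_σ_odd_neg_two (j : ℕ) : (σ (2 * j + 1)).eval (-2) = (-1) ^ j * (2 * j + 1) := by
  induction j using Nat.twoStepInduction with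
  | zero => simp [σ]
  | one =>
    simp [σ]
    norm_num
  | more j h0 h1 =>
    rw [show 2 * (j + 2) + 1 = 2 * j + 1 + 4 by ring, σ_add_four,
      show 2 * j + 1 + 2 = 2 * (j + 1) + 1 by ring,
      Polynomial.eval_sub, Polynomial.eval_mul, Polynomial.eval_X, h0, h1]
    push_cast
    ring

theorem eval_f {u : ℂ} (hu : u ≠ 0) (j : ℕ) : (f j).eval (u + u⁻¹) = u ^ j + u⁻¹ ^ j := by
  induction j using Nat.twoStepInduction with
  | zero =>
    simp [f]
    norm_num
  | one => simp [f]
  | more j h0 h1 =>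
    rw [f, Polynomial.eval_sub, Polynomial.eval_mul, Polynomial.eval_X, h0, h1]
    have e : u * u⁻¹ = 1 := mul_inv_cancel₀ hu
    linear_combination (u ^ j + u⁻¹ ^ j) * e

theorem sub_inv_ne_zero {u : ℂ} (hu : u ≠ 0) (h1 : u ≠ 1) (h2 : u ≠ -1) : u - u⁻¹ ≠ 0 := by
  intro e
  have : (u - 1) * (u + 1) = 0 := by
    field_simp at e
    linear_combination e
  rcases mul_eq_zero.1 this with e | e
  · exact h1 (sub_eq_zero.1 e)
  · exact h2 (eq_neg_of_add_eq_zero_left e)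

/-- For k = 2j the condition u^j = u^(-j) is u^k = 1, and the values ±j at u = ±1 are nonzero. For
odd k only u = 1 needs care, since −1 is not a k-th root of unity. -/
theorem eval_s_eq_zero_iff {k : ℕ} (hk : 0 < k) {u : ℂ} (hu : u ≠ 0) :
    (s k).eval (u + u⁻¹) = 0 ↔ u ^ k = 1 ∧ u ≠ 1 ∧ u ≠ -1 := by
  obtain ⟨j, rfl | rfl⟩ := Nat.even_or_odd' k
  · have hj : (j : ℂ) ≠ 0 := by
      norm_cast
      omega
    by_cases h1 : u = 1
    · subst h1
      norm_num [eval_s_even_two, hj]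
    by_cases h2 : u = -1
    · subst h2
      have := eval_s_even_neg_two j
      norm_num at this ⊢
      rw [this]
      norm_num [hj]
    have h3 := sub_inv_ne_zero hu h1 h2
    rw [← mul_eq_zero_iff_right h3, eval_s_even hu, sub_eq_zero, inv_pow,
      ← mul_eq_one_iff_eq_inv₀ (pow_ne_zero _ hu), two_mul, pow_add]
    simp [h1, h2]
  · by_cases h1 : u = 1
    · subst h1
      have := eval_s_odd_two j
      norm_num at this ⊢
      rw [this]
      norm_cast
    have h3 : u ^ j ≠ 0 := pow_ne_zero _ hu
    rw [← mul_eq_zero_iff_right (sub_ne_zero.2 h1), ← mul_eq_zero_iff_right h3, eval_s_odd hu,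
      sub_eq_zero]
    refine ⟨fun e => ⟨e, h1, ?_⟩, fun e => e.1⟩
    rintro rfl
    rw [Odd.neg_one_pow ⟨j, rfl⟩] at e
    norm_num at e

/-- For even k the condition u^(k/2) = −u^(-k/2) is u^k = −1, which already excludes ±1. For odd k
the root u = −1 is cancelled by the factor u + 1, and the value there is ±k. -/
theorem eval_g_eq_zero_iff (k : ℕ) {u : ℂ} (hu : u ≠ 0) :
    (g k).eval (u + u⁻¹) = 0 ↔ u ^ k = -1 ∧ u ≠ 1 ∧ u ≠ -1 := by
  obtain ⟨j, rfl | rfl⟩ := Nat.even_or_odd' k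
  · rw [g, if_neg (by simp), Nat.mul_div_cancel_left _ two_pos, eval_f hu,
      add_eq_zero_iff_eq_neg, inv_pow, ← inv_neg,
      ← mul_eq_one_iff_eq_inv₀ (neg_ne_zero.2 (pow_ne_zero _ hu)), mul_neg, neg_eq_iff_eq_neg,
      ← pow_add, ← two_mul]
    refine ⟨fun e => ⟨e, ?_, ?_⟩, fun e => e.1⟩ <;> rintro rfl <;> norm_num at e
  · rw [g, if_pos ⟨j, rfl⟩]
    by_cases h1 : u = -1
    · subst h1
      have := eval_σ_odd_neg_two j
      norm_num at this ⊢
      rw [this]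
      norm_num
      norm_cast
    have h3 : u ^ j ≠ 0 := pow_ne_zero _ hu
    have h4 : u + 1 ≠ 0 := fun e => h1 (eq_neg_of_add_eq_zero_left e)
    rw [← mul_eq_zero_iff_right h4, ← mul_eq_zero_iff_right h3, eval_σ_odd hu,
      add_eq_zero_iff_eq_neg]
    refine ⟨fun e => ⟨e, ?_, h1⟩, fun e => e.1⟩
    rintro rfl
    norm_num at e

/-! ### The lines of `V(I₁) ∪ V(I₂)` -/

/-- Pairs of eigenvalues, all different from `1` and `-1`, with `u ^ m = v ^ n = ± 1`. -/
def pairs (m n : ℕ) : Set (ℂ × ℂ) :=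
  {q | (q.1 ≠ 1 ∧ q.1 ≠ -1) ∧ (q.2 ≠ 1 ∧ q.2 ≠ -1) ∧ q.1 ^ m = q.2 ^ n ∧ q.1 ^ m * q.2 ^ n = 1}

/-- The vertical line of points with first coordinates `u + u⁻¹` and `v + v⁻¹`. -/
def lineOf (q : ℂ × ℂ) : Set (Fin 3 → ℂ) := {p | p 0 = q.1 + q.1⁻¹ ∧ p 1 = q.2 + q.2⁻¹}

theorem pairs_ne_zero {m n : ℕ} (hm : 0 < m) (hn : 0 < n) {q : ℂ × ℂ} (hq : q ∈ pairs m n) :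
    q.1 ≠ 0 ∧ q.2 ≠ 0 := by
  obtain ⟨-, -, -, h4⟩ := hq
  constructor <;> intro e <;> simp [e, hm.ne', hn.ne'] at h4

theorem mem_V_I₁_union_V_I₂ {m n : ℕ} (hm : 0 < m) (hn : 0 < n) (p : Fin 3 → ℂ) :
    p ∈ V (I₁ m n) ∪ V (I₂ m n) ↔ ∃ q ∈ pairs m n, p ∈ lineOf q := by
  obtain ⟨u, hu, h0⟩ := exists_add_inv (p 0)
  obtain ⟨v, hv, h1⟩ := exists_add_inv (p 1)
  have key : ∀ {u v : ℂ}, u ≠ 0 → v ≠ 0 → p 0 = u + u⁻¹ → p 1 = v + v⁻¹ →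
      (p ∈ V (I₁ m n) ∪ V (I₂ m n) ↔ (u, v) ∈ pairs m n) := by
    intro u v hu hv h0 h1
    rw [Set.mem_union, I₁, I₂, mem_V_span, mem_V_span]
    simp only [Set.mem_insert_iff, Set.mem_singleton_iff, forall_eq_or_imp, forall_eq, eval_inVar,
      h0, h1, eval_s_eq_zero_iff hm hu, eval_s_eq_zero_iff hn hv, eval_g_eq_zero_iff m hu,
      eval_g_eq_zero_iff n hv, pairs, Set.mem_ofPred_eq]
    constructor
    · rintro (⟨⟨a, b⟩, c, d⟩ | ⟨⟨a, b⟩, c, d⟩) <;> exact ⟨b, d, by rw [a, c], by rw [a, c]; norm_num⟩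
    · rintro ⟨b, d, e1, e2⟩
      -- The common value u^m = v^n squares to 1; its sign decides between `I₁` and `I₂`.
      rw [← e1, mul_self_eq_one_iff] at e2
      rcases e2 with e2 | e2
      · exact .inl ⟨⟨e2, b⟩, e1 ▸ e2, d⟩
      · exact .inr ⟨⟨e2, b⟩, e1 ▸ e2, d⟩
  constructor
  · exact fun h => ⟨(u, v), (key hu hv h0 h1).1 h, h0, h1⟩
  · rintro ⟨⟨u, v⟩, hq, h0, h1⟩
    obtain ⟨hu, hv⟩ := pairs_ne_zero hm hn hq
    exact (key hu hv h0 h1).2 hq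

/-! ### The character variety -/

/-- At the traces of A and B, `D` equals tr(ABA⁻¹B⁻¹) − 2. The proof uses an explicit combination of
the entrywise relations. -/
theorem eval_D_eq_zero_of_commute (A B : SL(2, ℂ)) (hAB : A * B = B * A) :
    MvPolynomial.eval ![tr A, tr B, tr (A * B)] D = 0 := by
  have hM : (A : Matrix (Fin 2) (Fin 2) ℂ) * B = B * A := by
    rw [← Matrix.SpecialLinearGroup.coe_mul, hAB, Matrix.SpecialLinearGroup.coe_mul]
  have hA := A.det_coe
  have hB := B.det_coe
  rw [Matrix.det_fin_two] at hA hB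
  have h00 := congrFun (congrFun hM 0) 0
  have h01 := congrFun (congrFun hM 0) 1
  have h10 := congrFun (congrFun hM 1) 0
  rw [eval_D]
  simp only [tr, Matrix.SpecialLinearGroup.coe_mul, Matrix.trace_fin_two, Matrix.mul_apply,
    Fin.sum_univ_two, Matrix.cons_val_zero, Matrix.cons_val_one, Matrix.cons_val] at *
  generalize (A : Matrix (Fin 2) (Fin 2) ℂ) 0 0 = a at *
  generalize (A : Matrix (Fin 2) (Fin 2) ℂ) 0 1 = b at *
  generalize (A : Matrix (Fin 2) (Fin 2) ℂ) 1 0 = c at *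
  generalize (A : Matrix (Fin 2) (Fin 2) ℂ) 1 1 = d at *
  generalize (B : Matrix (Fin 2) (Fin 2) ℂ) 0 0 = a' at *
  generalize (B : Matrix (Fin 2) (Fin 2) ℂ) 0 1 = b' at *
  generalize (B : Matrix (Fin 2) (Fin 2) ℂ) 1 0 = c' at *
  generalize (B : Matrix (Fin 2) (Fin 2) ℂ) 1 1 = d' at *
  linear_combination (b * c' - b' * c) * h00 + (c * a' + d * c' - c' * a - d' * c) * h01
    - (a + d) ^ 2 * hB - (a' + d') ^ 2 * hA + 4 * (a * d - b * c) * hB + 4 * hA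

/-- Matrices with prescribed traces. -/
theorem exists_tr_eq (p : Fin 3 → ℂ) : ∃ A B : SL(2, ℂ), p = ![tr A, tr B, tr (A * B)] := by
  -- The product of the two matrices below has diagonal entries t⁻¹ and t, so t must satisfy t + t⁻¹
  -- = p 2.
  obtain ⟨t, ht, h2⟩ := exists_add_inv (p 2)
  let A : SL(2, ℂ) := ⟨!![p 0, -1; 1, 0], by simp [Matrix.det_fin_two]⟩
  let B : SL(2, ℂ) := ⟨!![0, t; -t⁻¹, p 1], by simp [Matrix.det_fin_two, ht]⟩
  refine ⟨A, B, ?_⟩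
  have hA : (A : Matrix (Fin 2) (Fin 2) ℂ) = !![p 0, -1; 1, 0] := rfl
  have hB : (B : Matrix (Fin 2) (Fin 2) ℂ) = !![0, t; -t⁻¹, p 1] := rfl
  ext i
  fin_cases i
  · simp [tr, hA, Matrix.trace_fin_two]
  · simp [tr, hB, Matrix.trace_fin_two]
  · simp [tr, hA, hB, Matrix.trace_fin_two, h2, add_comm]

theorem mem_charVariety_iff (m n : ℕ) (p : Fin 3 → ℂ) :
    p ∈ charVariety m n ↔ ∃ A B : SL(2, ℂ), A ^ m = B ^ n ∧ p = ![tr A, tr B, tr (A * B)] := by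
  constructor
  · rintro ⟨ρ, rfl⟩
    refine ⟨ρ (G.x m n), ρ (G.y m n), ?_, by rw [map_mul]⟩
    rw [← map_pow, ← map_pow]
    congr 1
    have : (PresentedGroup.mk ({FreeGroup.of 0 ^ m * (FreeGroup.of 1 ^ n)⁻¹} :
        Set (FreeGroup (Fin 2)))) (FreeGroup.of 0 ^ m * (FreeGroup.of 1 ^ n)⁻¹) = 1 :=
      PresentedGroup.one_of_mem (Set.mem_singleton _)
    rw [map_mul, map_inv, map_pow, map_pow, mul_inv_eq_one] at this
    exact this
  · rintro ⟨A, B, e, rfl⟩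
    have hr : ∀ r ∈ ({FreeGroup.of 0 ^ m * (FreeGroup.of 1 ^ n)⁻¹} : Set (FreeGroup (Fin 2))),
        FreeGroup.lift ![A, B] r = 1 := by
      rintro r rfl
      simp [e]
    refine ⟨PresentedGroup.toGroup hr, ?_⟩
    rw [map_mul, G.x, G.y, PresentedGroup.toGroup.of, PresentedGroup.toGroup.of]
    rfl

theorem eval_h_ne_zero_of_tr {k : ℕ} (hk : 0 < k) {u : ℂ} (h1 : u = 1 ∨ u = -1) :
    (h k).eval (u + u⁻¹) ≠ 0 := by
  have hk' : (k : ℂ) ≠ 0 := by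
    norm_cast
    omega
  rcases h1 with rfl | rfl
  · rw [h, show (1 : ℂ) + 1⁻¹ = 2 by norm_num, Polynomial.Chebyshev.S_eval_two]
    simpa using hk'
  · rw [h, show (-1 : ℂ) + (-1)⁻¹ = -2 by norm_num, Polynomial.Chebyshev.S_eval_neg_two]
    simpa using hk'

theorem coe_pow_eq (A : SL(2, ℂ)) (k : ℕ) : ((A ^ k : SL(2, ℂ)) : Matrix (Fin 2) (Fin 2) ℂ) =
    (h k).eval (tr A) • (A : Matrix (Fin 2) (Fin 2) ℂ) - ((h (k - 1)).eval (tr A)) • 1 := by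
  rw [← sl_zpow, zpow_natCast]

/-- By Cayley–Hamilton A^k = h_k(tr A)·A + scalar, so the commutator of A^k and B is h_k(tr A) times
that of A and B. -/
theorem eval_h_tr_eq_zero {A B : SL(2, ℂ)} {k : ℕ} (hAB : A * B ≠ B * A)
    (hc : A ^ k * B = B * A ^ k) : (h k).eval (tr A) = 0 := by
  by_contra hne
  apply hAB
  apply Subtype.ext
  have := congrArg (fun M : SL(2, ℂ) => (M : Matrix (Fin 2) (Fin 2) ℂ)) hc
  simp only [Matrix.SpecialLinearGroup.coe_mul, coe_pow_eq] at this ⊢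
  simp only [sub_mul, mul_sub, smul_mul_assoc, mul_smul_comm, one_mul, mul_one,
    sub_left_inj] at this
  exact smul_right_injective _ hne this

/-- Subtracting the formulas for u^k and u^(-k) gives h_k(u + u⁻¹)(u − u⁻¹) = u^k − u^(-k); at u =
±1 the value of h_k is ±k. -/
theorem eval_h_eq_zero_iff {k : ℕ} (hk : 0 < k) {u : ℂ} (hu : u ≠ 0) :
    (h k).eval (u + u⁻¹) = 0 ↔ (u ≠ 1 ∧ u ≠ -1) ∧ u ^ k = u⁻¹ ^ k := by
  have e1 := zpow_eq_eval_h hu k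
  have e2 := zpow_eq_eval_h (inv_ne_zero hu) k
  rw [inv_inv, add_comm u⁻¹ u] at e2
  rw [zpow_natCast] at e1 e2
  constructor
  · intro e
    refine ⟨?_, ?_⟩
    · by_contra hcon
      exact eval_h_ne_zero_of_tr hk (u := u) (by tauto) e
    · rw [e1, e2, e]
      simp
  · rintro ⟨⟨h1, h2⟩, e⟩
    have : (h k).eval (u + u⁻¹) * (u - u⁻¹) = 0 := by
      linear_combination e2 - e1 + e
    exact (mul_eq_zero.1 this).resolve_right (sub_inv_ne_zero hu h1 h2)

theorem pow_eq_neg_eval_h {k : ℕ} {u : ℂ} (hu : u ≠ 0) (hk : (h k).eval (u + u⁻¹) = 0) :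
    u ^ k = -(h (k - 1)).eval (u + u⁻¹) := by
  rw [← zpow_natCast, zpow_eq_eval_h hu, hk]
  simp

theorem charVariety_eq {m n : ℕ} (hm : 0 < m) (hn : 0 < n) :
    charVariety m n = (V (I₁ m n) ∪ V (I₂ m n)) ∪ V (I₃ m n) := by
  ext p
  rw [mem_charVariety_iff, Set.mem_union, mem_V_I₁_union_V_I₂ hm hn]
  constructor
  · rintro ⟨A, B, e, rfl⟩
    by_cases hD : MvPolynomial.eval ![tr A, tr B, tr (A * B)] D = 0
    · right
      rw [mem_V_I₃, eval_F, eval_F, eval_F]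
      have e' : A ^ (m : ℤ) * B ^ (-(n : ℤ)) = 1 := by
        rw [zpow_neg, zpow_natCast, zpow_natCast, e, mul_inv_cancel]
      refine ⟨?_, ?_, ?_, hD⟩
      · rw [e']
        simp [tr]
      · rw [add_comm, zpow_add, mul_assoc, e']
        simp
      · rw [neg_sub, sub_eq_add_neg, add_comm, zpow_add, ← mul_assoc, e']
        simp
    · left
      have hAB : A * B ≠ B * A := fun hAB => hD (eval_D_eq_zero_of_commute A B hAB)
      have hA := eval_h_tr_eq_zero (k := m) hAB (by rw [e, ← pow_succ, ← pow_succ'])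
      have hB := eval_h_tr_eq_zero (k := n) hAB.symm (by rw [← e, ← pow_succ, ← pow_succ'])
      obtain ⟨u, hu, h0⟩ := exists_add_inv (tr A)
      obtain ⟨v, hv, h1⟩ := exists_add_inv (tr B)
      -- Both powers are scalar now, so comparing one diagonal entry yields u^m = v^n.
      have hM : ((A ^ m : SL(2, ℂ)) : Matrix (Fin 2) (Fin 2) ℂ) 0 0 =
        ((B ^ n : SL(2, ℂ)) : Matrix (Fin 2) (Fin 2) ℂ) 0 0 := by rw [e]
      rw [coe_pow_eq, coe_pow_eq, hA, hB] at hM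
      simp only [zero_smul, zero_sub, Matrix.neg_apply, Matrix.smul_apply, Matrix.one_apply_eq,
        smul_eq_mul, mul_one] at hM
      rw [h0] at hA hM
      rw [h1] at hB hM
      rw [← pow_eq_neg_eval_h hu hA, ← pow_eq_neg_eval_h hv hB] at hM
      rw [eval_h_eq_zero_iff hm hu] at hA
      rw [eval_h_eq_zero_iff hn hv] at hB
      refine ⟨(u, v), ⟨hA.1, hB.1, hM, ?_⟩, h0, h1⟩
      change u ^ m * v ^ n = 1
      rw [← hM]
      nth_rewrite 2 [hA.2]
      rw [inv_pow, mul_inv_cancel₀ (pow_ne_zero _ hu)]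
  · rintro (⟨⟨u, v⟩, hq, h0, h1⟩ | hp)
    -- Any pair with these traces works: A^m and B^n are the same scalar matrix whatever the trace
    -- of AB is.
    · obtain ⟨A, B, rfl⟩ := exists_tr_eq p
      refine ⟨A, B, ?_, rfl⟩
      obtain ⟨hu, hv⟩ := pairs_ne_zero hm hn hq
      obtain ⟨h3, h4, h5, h6⟩ := hq
      simp only [Matrix.cons_val_zero, Matrix.cons_val_one] at h0 h1 h3 h4 h5 h6 hu hv
      have hA := (eval_h_eq_zero_iff hm hu).2 ⟨h3, by
        rw [inv_pow, ← mul_eq_one_iff_eq_inv₀ (pow_ne_zero _ hu), ← h6, ← h5]⟩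
      have hB := (eval_h_eq_zero_iff hn hv).2 ⟨h4, by
        rw [inv_pow, ← mul_eq_one_iff_eq_inv₀ (pow_ne_zero _ hv), ← h6, ← h5]⟩
      apply Subtype.ext
      rw [coe_pow_eq, coe_pow_eq, h0, h1, hA, hB, zero_smul, zero_smul, zero_sub, zero_sub,
        ← neg_smul, ← neg_smul, ← pow_eq_neg_eval_h hu hA, ← pow_eq_neg_eval_h hv hB, h5]
    · rw [mem_V_I₃_iff_exists] at hp
      obtain ⟨u, v, hu, hv, e, rfl⟩ := hp
      refine ⟨diagSL (Units.mk0 u hu), diagSL (Units.mk0 v hv), ?_, ?_⟩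
      · rw [← map_pow, ← map_pow]
        congr 1
        ext
        simpa using e
      · rw [← map_mul, tr_diagSL, tr_diagSL, tr_diagSL]
        simp [pt]

/-! ### Finiteness, and the straight lines of the character variety -/

theorem finite_pow_eq {k : ℕ} (hk : 0 < k) (c : ℂ) : {x : ℂ | x ^ k = c}.Finite :=
  ((Polynomial.nthRoots k c).toFinset.finite_toSet).subset fun x hx => by
    simpa [Polynomial.mem_nthRoots hk] using hx

/-- A fixed coordinate determines u, v or uv up to inversion, and u^m = v^n leaves finitely many
choices for the rest. In the third case it reads u^(m+n) = (uv)^n. -/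
theorem finite_V_I₃_fiber {m n : ℕ} (hm : 0 < m) (hn : 0 < n) (i : Fin 3) (a : ℂ) :
    {p ∈ V (I₃ m n) | p i = a}.Finite := by
  obtain ⟨z, hz, rfl⟩ := exists_add_inv a
  fin_cases i
  · refine (Set.Finite.biUnion (Set.toFinite {z, z⁻¹}) fun u _ =>
      (finite_pow_eq hn (u ^ m)).image fun v => pt u v).subset ?_
    rintro p ⟨hp, h0⟩
    obtain ⟨u, v, hu, hv, e, rfl⟩ := (mem_V_I₃_iff_exists m n p).1 hp
    exact Set.mem_biUnion ((add_inv_eq_add_inv_iff hu hz).1 h0) ⟨v, e.symm, rfl⟩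
  · refine (Set.Finite.biUnion (Set.toFinite {z, z⁻¹}) fun v _ =>
      (finite_pow_eq hm (v ^ n)).image fun u => pt u v).subset ?_
    rintro p ⟨hp, h0⟩
    obtain ⟨u, v, hu, hv, e, rfl⟩ := (mem_V_I₃_iff_exists m n p).1 hp
    exact Set.mem_biUnion ((add_inv_eq_add_inv_iff hv hz).1 h0) ⟨u, e, rfl⟩
  · refine (Set.Finite.biUnion (Set.toFinite {z, z⁻¹}) fun q _ =>
      (finite_pow_eq (Nat.add_pos_left hm n) (q ^ n)).image fun u => pt u (u⁻¹ * q)).subset ?_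
    rintro p ⟨hp, h0⟩
    obtain ⟨u, v, hu, hv, e, rfl⟩ := (mem_V_I₃_iff_exists m n p).1 hp
    refine Set.mem_biUnion ((add_inv_eq_add_inv_iff (mul_ne_zero hu hv) hz).1 h0) ⟨u, ?_, ?_⟩
    · change u ^ (m + n) = (u * v) ^ n
      rw [pow_add, e, mul_pow, mul_comm]
    · simp only [inv_mul_cancel_left₀ hu]

/-- If the direction has a zero entry, a coordinate is constant on the line. Otherwise `D` restricts
to a cubic in t with leading coefficient −v₀v₁v₂ ≠ 0. -/
theorem finite_line_inter_V_I₃ {m n : ℕ} (hm : 0 < m) (hn : 0 < n) {p v : Fin 3 → ℂ}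
    (hv : v ≠ 0) : {t : ℂ | p + t • v ∈ V (I₃ m n)}.Finite := by
  by_cases h0 : ∃ i, v i = 0
  · obtain ⟨i, hi⟩ := h0
    have hinj : Function.Injective fun t : ℂ => p + t • v :=
      (add_right_injective p).comp (smul_left_injective ℂ hv)
    refine ((finite_V_I₃_fiber hm hn i (p i)).preimage hinj.injOn).subset fun t ht => ⟨ht, ?_⟩
    simp [hi]
  · push Not at h0
    let ℓ : Fin 3 → Polynomial ℂ := fun i => Polynomial.C (p i) + Polynomial.X * Polynomial.C (v i)
    let Q : Polynomial ℂ := ℓ 0 ^ 2 + ℓ 1 ^ 2 + ℓ 2 ^ 2 - ℓ 0 * ℓ 1 * ℓ 2 - Polynomial.C 4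
    have hQ (t : ℂ) : Q.eval t = MvPolynomial.eval (p + t • v) D := by
      simp [Q, ℓ, eval_D]
      ring
    have hQ0 : Q ≠ 0 := by
      intro e
      simp only [e, Polynomial.eval_zero, eval_D, Pi.add_apply, Pi.smul_apply, smul_eq_mul] at hQ
      have : 6 * (v 0 * v 1 * v 2) = 0 := by
        -- The third finite difference at −1, 0, 1, 2 isolates six times the leading coefficient.
        linear_combination hQ 2 - 3 * hQ 1 + 3 * hQ 0 - hQ (-1)
      simp [h0] at this
    refine (Polynomial.finite_setOfPred_isRoot hQ0).subset fun t ht => ?_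
    exact (hQ t).trans ((mem_V_I₃ m n _).1 ht).2.2.2

theorem finite_pairs {m n : ℕ} (hm : 0 < m) (hn : 0 < n) : (pairs m n).Finite := by
  refine ((finite_pow_eq (k := 2 * m) (by omega) 1).prod
    (finite_pow_eq (k := 2 * n) (by omega) 1)).subset ?_
  rintro ⟨u, v⟩ ⟨-, -, h1, h2⟩
  simp only at h1 h2
  constructor
  · change u ^ (2 * m) = 1
    rw [two_mul, pow_add]
    nth_rewrite 2 [h1]
    exact h2
  · change v ^ (2 * n) = 1
    rw [two_mul, pow_add]
    nth_rewrite 1 [← h1]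
    exact h2

theorem lineOf_eq_range (q : ℂ × ℂ) : lineOf q =
    Set.range fun t : ℂ => ![q.1 + q.1⁻¹, q.2 + q.2⁻¹, 0] + t • ![0, 0, 1] := by
  ext p
  constructor
  · rintro ⟨h0, h1⟩
    refine ⟨p 2, ?_⟩
    ext i
    fin_cases i <;> simp [h0, h1]
  · rintro ⟨t, rfl⟩
    simp [lineOf]

theorem isStraightLine_lineOf (q : ℂ × ℂ) : IsStraightLine (lineOf q) :=
  ⟨_, ![0, 0, 1], by simp, lineOf_eq_range q⟩

/-- There are finitely many vertical lines, and only finitely many parameters land in `V (I₃ m n)`,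
so infinitely many land in one vertical line. Two of them already force the direction to be
vertical. -/
theorem IsStraightLine.eq_lineOf {m n : ℕ} (hm : 0 < m) (hn : 0 < n) {L : Set (Fin 3 → ℂ)}
    (hL : IsStraightLine L) (hs : L ⊆ (V (I₁ m n) ∪ V (I₂ m n)) ∪ V (I₃ m n)) :
    ∃ q ∈ pairs m n, lineOf q = L := by
  obtain ⟨p, v, hv, rfl⟩ := hL
  obtain ⟨q, hq, hinf⟩ : ∃ q ∈ pairs m n, {t : ℂ | p + t • v ∈ lineOf q}.Infinite := by
    by_contra! hcon
    refine Set.infinite_univ (α := ℂ) (((Set.Finite.biUnion (finite_pairs hm hn) hcon).union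
      (finite_line_inter_V_I₃ hm hn (p := p) hv)).subset fun t _ => ?_)
    rcases hs ⟨t, rfl⟩ with h | h
    · obtain ⟨q, hq, h⟩ := (mem_V_I₁_union_V_I₂ hm hn _).1 h
      exact .inl (Set.mem_biUnion hq h)
    · exact .inr h
  refine ⟨q, hq, ?_⟩
  obtain ⟨t, ht, t', ht', hne⟩ := hinf.nontrivial
  obtain ⟨a0, a1⟩ := ht
  obtain ⟨b0, b1⟩ := ht'
  simp only [Pi.add_apply, Pi.smul_apply, smul_eq_mul] at a0 a1 b0 b1
  have v0 : v 0 = 0 := by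
    have : (t - t') * v 0 = 0 := by linear_combination a0 - b0
    exact (mul_eq_zero.1 this).resolve_left (sub_ne_zero.2 hne)
  have v1 : v 1 = 0 := by
    have : (t - t') * v 1 = 0 := by linear_combination a1 - b1
    exact (mul_eq_zero.1 this).resolve_left (sub_ne_zero.2 hne)
  have v2 : v 2 ≠ 0 := by
    intro v2
    apply hv
    ext i
    fin_cases i
    exacts [v0, v1, v2]
  rw [v0, mul_zero, add_zero] at a0
  rw [v1, mul_zero, add_zero] at a1
  ext x
  constructor
  · rintro ⟨h0, h1⟩
    refine ⟨(x 2 - p 2) / v 2, ?_⟩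
    ext i
    fin_cases i
    · simp [v0, a0, h0]
    · simp [v1, a1, h1]
    · simp [v2]
  · rintro ⟨t, rfl⟩
    simp [lineOf, v0, v1, a0, a1]

theorem lines_eq_image {m n : ℕ} (hm : 0 < m) (hn : 0 < n) :
    lines m n = lineOf '' pairs m n := by
  ext L
  constructor
  · rintro ⟨hL, hs⟩
    exact hL.eq_lineOf hm hn (hs.trans Set.subset_union_left)
  · rintro ⟨q, hq, rfl⟩
    exact ⟨isStraightLine_lineOf q, fun p hp => (mem_V_I₁_union_V_I₂ hm hn p).2 ⟨q, hq, hp⟩⟩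

theorem straightLines_charVariety_eq {m n : ℕ} (hm : 0 < m) (hn : 0 < n) :
    {L | IsStraightLine L ∧ L ⊆ charVariety m n} = lines m n := by
  ext L
  constructor
  · rintro ⟨hL, hs⟩
    rw [charVariety_eq hm hn] at hs
    rw [lines_eq_image hm hn]
    exact hL.eq_lineOf hm hn hs
  · rintro ⟨hL, hs⟩
    refine ⟨hL, ?_⟩
    rw [charVariety_eq hm hn]
    exact hs.trans Set.subset_union_left

theorem V_I₁_union_V_I₂_eq_sUnion {m n : ℕ} (hm : 0 < m) (hn : 0 < n) :
    V (I₁ m n) ∪ V (I₂ m n) = ⋃₀ lines m n := by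
  ext p
  rw [mem_V_I₁_union_V_I₂ hm hn, lines_eq_image hm hn]
  simp

/-! ### Intersections of lines and curves -/

theorem mem_lineOf_iff_of_eval_D {u v : ℂ} (hu : u ≠ 0) (hv : v ≠ 0) {p : Fin 3 → ℂ} :
    p ∈ lineOf (u, v) ∧ MvPolynomial.eval p D = 0 ↔ p = pt u v ∨ p = pt u v⁻¹ := by
  constructor
  · rintro ⟨⟨h0, h1⟩, hD⟩
    exact eq_pt_or_of_eval_D hu hv h0 h1 hD
  · rintro (rfl | rfl)
    · exact ⟨⟨rfl, rfl⟩, eval_D_pt hu hv⟩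
    · exact ⟨⟨rfl, by simp [add_comm]⟩, eval_D_pt hu (inv_ne_zero hv)⟩

theorem pt_ne_pt_inv {u v : ℂ} (hu : u ≠ 0) (hv : v ≠ 0) (hu1 : u ≠ 1 ∧ u ≠ -1)
    (hv1 : v ≠ 1 ∧ v ≠ -1) : pt u v ≠ pt u v⁻¹ := by
  intro e
  have := congrFun e 2
  rw [pt_two, pt_two, mul_inv, mul_inv, inv_inv] at this
  -- This product is the difference of the third coordinates of the two points.
  have : (u - u⁻¹) * (v - v⁻¹) = 0 := by linear_combination this
  rcases mul_eq_zero.1 this with e | e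
  exacts [sub_inv_ne_zero hu hu1.1 hu1.2 e, sub_inv_ne_zero hv hv1.1 hv1.2 e]

theorem pt_mem_C_iff {m' n' : ℕ} {u v w : ℂ} (hu : u ≠ 0) (hv : v ≠ 0) (hw : w ≠ 0) :
    pt u v ∈ C m' n' w ↔
      u ^ m' * (v ^ n')⁻¹ + (u ^ m' * (v ^ n')⁻¹)⁻¹ = w + w⁻¹ := by
  rw [mem_C_iff hw, eval_F_pt _ _ hu hv, zpow_neg, zpow_natCast, zpow_natCast]
  exact and_iff_left (eval_D_pt hu hv)

/-- The line meets `D = 0` only in these two points. Curves are equal or disjoint, so membership of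
a point becomes equality of its own curve with C_w. -/
theorem mem_lineOf_inter_C {m' n' : ℕ} {u v w : ℂ} (hu : u ≠ 0) (hv : v ≠ 0) (hw : w ≠ 0)
    (p : Fin 3 → ℂ) : p ∈ lineOf (u, v) ∩ C m' n' w ↔
      p = pt u v ∧ C m' n' (u ^ m' * (v ^ n')⁻¹) = C m' n' w ∨
        p = pt u v⁻¹ ∧ C m' n' (u ^ m' * v ^ n') = C m' n' w := by
  have mem_iff {x : Fin 3 → ℂ} {z : ℂ} (hz : z ≠ 0) (hx : x ∈ C m' n' z) :
      x ∈ C m' n' w ↔ C m' n' z = C m' n' w := by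
    refine ⟨fun hx' => ?_, fun e => e ▸ hx⟩
    by_contra hne
    exact Set.disjoint_left.1 (disjoint_C hz hw hne) hx hx'
  have h1 : u ^ m' * (v ^ n')⁻¹ ≠ 0 := by positivity
  have h2 : u ^ m' * v ^ n' ≠ 0 := by positivity
  rw [← mem_iff h1 ((pt_mem_C_iff hu hv h1).2 rfl),
    ← mem_iff h2 ((pt_mem_C_iff hu (inv_ne_zero hv) h2).2 (by rw [inv_pow, inv_inv]))]
  constructor
  · rintro ⟨hp, hC⟩
    rcases (mem_lineOf_iff_of_eval_D hu hv).1 ⟨hp, ((mem_C_iff hw p).1 hC).2⟩ with rfl | rfl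
    · exact .inl ⟨rfl, hC⟩
    · exact .inr ⟨rfl, hC⟩
  · rintro (⟨rfl, hC⟩ | ⟨rfl, hC⟩)
    · exact ⟨((mem_lineOf_iff_of_eval_D hu hv).2 (.inl rfl)).1, hC⟩
    · exact ⟨((mem_lineOf_iff_of_eval_D hu hv).2 (.inr rfl)).1, hC⟩

theorem ncard_lineOf_inter_V_I₃ {m n : ℕ} (hm : 0 < m) (hn : 0 < n) {q : ℂ × ℂ}
    (hq : q ∈ pairs m n) : (lineOf q ∩ V (I₃ m n)).ncard = 2 := by
  obtain ⟨u, v⟩ := q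
  obtain ⟨hu, hv⟩ := pairs_ne_zero hm hn hq
  obtain ⟨h1, h2, h3, h4⟩ := hq
  simp only at *
  have : lineOf (u, v) ∩ V (I₃ m n) = {pt u v, pt u v⁻¹} := by
    ext p
    rw [Set.mem_insert_iff, Set.mem_singleton_iff, ← mem_lineOf_iff_of_eval_D hu hv]
    constructor
    · rintro ⟨hp, h⟩
      exact ⟨hp, ((mem_V_I₃ m n p).1 h).2.2.2⟩
    · intro h
      refine ⟨h.1, (mem_V_I₃_iff_exists m n p).2 ?_⟩
      rcases (mem_lineOf_iff_of_eval_D hu hv).1 h with rfl | rfl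
      · exact ⟨u, v, hu, hv, h3, rfl⟩
      · refine ⟨u, v⁻¹, hu, inv_ne_zero hv, ?_, rfl⟩
        rw [inv_pow]
        exact eq_inv_of_mul_eq_one_left h4
  rw [this, Set.ncard_pair (pt_ne_pt_inv hu hv h1 h2)]

theorem meetsTwice_lineOf_iff {m' n' : ℕ} {u v w : ℂ} (hu : u ≠ 0) (hv : v ≠ 0) (hw : w ≠ 0)
    (hne : pt u v ≠ pt u v⁻¹) : MeetsTwice (lineOf (u, v)) (C m' n' w) ↔
      C m' n' (u ^ m' * (v ^ n')⁻¹) = C m' n' w ∧ C m' n' (u ^ m' * v ^ n') = C m' n' w := by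
  rw [MeetsTwice]
  have key := mem_lineOf_inter_C (m' := m') (n' := n') hu hv hw
  constructor
  · intro h
    by_contra hcon
    have : (lineOf (u, v) ∩ C m' n' w).Subsingleton := by
      intro x hx y hy
      rw [key] at hx hy
      rcases hx with hx | hx <;> rcases hy with hy | hy
      · exact hx.1.trans hy.1.symm
      · exact absurd ⟨hx.2, hy.2⟩ hcon
      · exact absurd ⟨hy.2, hx.2⟩ hcon
      · exact hx.1.trans hy.1.symm
    have := (Set.ncard_le_one this.finite).2 fun x hx y hy => this hx hy
    omega
  · rintro ⟨h1, h2⟩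
    have : lineOf (u, v) ∩ C m' n' w = {pt u v, pt u v⁻¹} := by
      ext p
      rw [key]
      simp [h1, h2]
    rw [this, Set.ncard_pair hne]

theorem meetsPair_lineOf_iff {m' n' : ℕ} {u v w z : ℂ} (hu : u ≠ 0) (hv : v ≠ 0) (hw : w ≠ 0)
    (hz : z ≠ 0) (hne : pt u v ≠ pt u v⁻¹) (hwz : C m' n' w ≠ C m' n' z) :
    MeetsPair (lineOf (u, v)) (C m' n' w) (C m' n' z) ↔
      (C m' n' (u ^ m' * (v ^ n')⁻¹) = C m' n' w ∧ C m' n' (u ^ m' * v ^ n') = C m' n' z) ∨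
      (C m' n' (u ^ m' * (v ^ n')⁻¹) = C m' n' z ∧ C m' n' (u ^ m' * v ^ n') = C m' n' w) := by
  have kw := mem_lineOf_inter_C (m' := m') (n' := n') hu hv hw
  have kz := mem_lineOf_inter_C (m' := m') (n' := n') hu hv hz
  constructor
  · rintro ⟨P, Q, hPQ, hP, hQ⟩
    have h1 := (kw P).1 (hP ▸ Set.mem_singleton P)
    have h2 := (kz Q).1 (hQ ▸ Set.mem_singleton Q)
    rcases h1 with h1 | h1 <;> rcases h2 with h2 | h2
    · exact absurd (h1.1.trans h2.1.symm) hPQ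
    · exact .inl ⟨h1.2, h2.2⟩
    · exact .inr ⟨h2.2, h1.2⟩
    · exact absurd (h1.1.trans h2.1.symm) hPQ
  · rintro (⟨h1, h2⟩ | ⟨h1, h2⟩)
    · refine ⟨pt u v, pt u v⁻¹, hne, ?_, ?_⟩
      · ext p
        rw [kw, h1, h2]
        simp [hwz.symm]
      · ext p
        rw [kz, h1, h2]
        simp [hwz]
    · refine ⟨pt u v⁻¹, pt u v, hne.symm, ?_, ?_⟩
      · ext p
        rw [kw, h1, h2]
        simp [hwz.symm]
      · ext p
        rw [kz, h1, h2]
        simp [hwz]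

/-! ### Counting lines by pairs of eigenvalues -/

theorem ncard_eq_mul_ncard_image {α β : Type*} (φ : α → β) {S : Set α} (hS : S.Finite) {k : ℕ}
    (hk : ∀ a ∈ S, {b ∈ S | φ b = φ a}.ncard = k) : S.ncard = k * (φ '' S).ncard := by
  classical
  lift S to Finset α using hS
  rw [Set.ncard_coe_finset, ← Finset.coe_image, Set.ncard_coe_finset,
    Finset.card_eq_sum_card_image φ S, Finset.sum_const_nat (m := k), mul_comm]
  intro b hb
  obtain ⟨a, ha, rfl⟩ := Finset.mem_image.1 hb
  rw [← hk a ha, ← Set.ncard_coe_finset]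
  simp

theorem lineOf_eq_iff {q r : ℂ × ℂ} :
    lineOf q = lineOf r ↔ q.1 + q.1⁻¹ = r.1 + r.1⁻¹ ∧ q.2 + q.2⁻¹ = r.2 + r.2⁻¹ := by
  constructor
  · intro e
    have : ![q.1 + q.1⁻¹, q.2 + q.2⁻¹, 0] ∈ lineOf r := e ▸ ⟨rfl, rfl⟩
    exact this
  · rintro ⟨h0, h1⟩
    simp [lineOf, h0, h1]

theorem ne_inv_self {u : ℂ} (hu : u ≠ 0) (h1 : u ≠ 1 ∧ u ≠ -1) : u ≠ u⁻¹ :=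
  sub_ne_zero.1 (sub_inv_ne_zero hu h1.1 h1.2)

theorem inv_ne_one_and {u : ℂ} (h1 : u ≠ 1 ∧ u ≠ -1) : u⁻¹ ≠ 1 ∧ u⁻¹ ≠ -1 := by
  rw [Ne, Ne, inv_eq_one, inv_eq_iff_eq_inv, inv_neg, inv_one]
  exact h1

/-- A line fixes u and v separately up to inversion. All four choices are admissible since u^m = v^n
= ±1 is its own inverse, and they are distinct since u, v ≠ ±1. -/
theorem ncard_lineOf_fiber {m n : ℕ} (hm : 0 < m) (hn : 0 < n) {q : ℂ × ℂ} (hq : q ∈ pairs m n) :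
    {r ∈ pairs m n | lineOf r = lineOf q}.ncard = 4 := by
  obtain ⟨u, v⟩ := q
  obtain ⟨hu, hv⟩ := pairs_ne_zero hm hn hq
  have hq' := hq
  obtain ⟨h1, h2, h3, h4⟩ := hq'
  simp only at *
  have hu' := ne_inv_self hu h1
  have hv' := ne_inv_self hv h2
  have h5 : (u ^ m)⁻¹ = v ^ n := inv_eq_of_mul_eq_one_right h4
  have h6 : (v ^ n)⁻¹ = u ^ m := inv_eq_of_mul_eq_one_left h4
  have : {r ∈ pairs m n | lineOf r = lineOf (u, v)} =
      ({u, u⁻¹} : Set ℂ) ×ˢ ({v, v⁻¹} : Set ℂ) := by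
    ext ⟨x, y⟩
    simp only [Set.mem_sep_iff, Set.mem_prod, Set.mem_insert_iff, Set.mem_singleton_iff,
      lineOf_eq_iff]
    constructor
    · rintro ⟨hr, h7, h8⟩
      obtain ⟨hx, hy⟩ := pairs_ne_zero hm hn hr
      exact ⟨(add_inv_eq_add_inv_iff hx hu).1 h7, (add_inv_eq_add_inv_iff hy hv).1 h8⟩
    · rintro ⟨hx, hy⟩
      have hx0 : x ≠ 0 := by rcases hx with rfl | rfl <;> simp [hu]
      have hy0 : y ≠ 0 := by rcases hy with rfl | rfl <;> simp [hv]
      refine ⟨?_, (add_inv_eq_add_inv_iff hx0 hu).2 hx, (add_inv_eq_add_inv_iff hy0 hv).2 hy⟩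
      refine ⟨?_, ?_, ?_, ?_⟩
      · rcases hx with rfl | rfl
        exacts [h1, inv_ne_one_and h1]
      · rcases hy with rfl | rfl
        exacts [h2, inv_ne_one_and h2]
      · rcases hx with rfl | rfl <;> rcases hy with rfl | rfl <;>
          simp only [inv_pow, h6, h3]
      · rcases hx with rfl | rfl <;> rcases hy with rfl | rfl <;>
          simp only [inv_pow, h6, h3] <;> rw [← h4, h3]
  rw [this, Set.ncard_prod, Set.ncard_pair hu', Set.ncard_pair hv']

theorem four_mul_ncard_lines {m n : ℕ} (hm : 0 < m) (hn : 0 < n) (R : Set (Fin 3 → ℂ) → Prop) :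
    4 * {L ∈ lines m n | R L}.ncard = {q ∈ pairs m n | R (lineOf q)}.ncard := by
  rw [ncard_eq_mul_ncard_image lineOf (k := 4) ((finite_pairs hm hn).subset (Set.sep_subset _ _))]
  · congr 2
    rw [lines_eq_image hm hn]
    ext L
    constructor
    · rintro ⟨⟨q, hq, rfl⟩, h⟩
      exact ⟨q, ⟨hq, h⟩, rfl⟩
    · rintro ⟨q, ⟨hq, h⟩, rfl⟩
      exact ⟨⟨q, hq, rfl⟩, h⟩
  · rintro q ⟨hq, h⟩
    rw [← ncard_lineOf_fiber hm hn hq]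
    congr 1
    ext r
    constructor
    · rintro ⟨⟨hr, -⟩, e⟩
      exact ⟨hr, e⟩
    · rintro ⟨hr, e⟩
      exact ⟨⟨hr, e ▸ h⟩, e⟩

/-- The solutions of `u ^ k = p` other than `1` and `-1`. -/
def rootsNe (k : ℕ) (p : ℂ) : Set ℂ := {u | u ^ k = p ∧ u ≠ 1 ∧ u ≠ -1}

theorem finite_rootsNe {k : ℕ} (hk : 0 < k) (p : ℂ) : (rootsNe k p).Finite :=
  (finite_pow_eq hk p).subset fun _ hu => hu.1

theorem ncard_rootsNe {k : ℕ} (hk : 0 < k) {p : ℂ} (hp : p ≠ 0) :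
    ((rootsNe k p).ncard : ℚ) =
      k - (if 1 = p then 1 else 0) - (if (-1) ^ k = p then 1 else 0) := by
  have hζ := Complex.isPrimitiveRoot_exp k hk.ne'
  set R : Finset ℂ := (Polynomial.nthRoots k p).toFinset with hR
  have mem_R (u : ℂ) : u ∈ R ↔ u ^ k = p := by
    rw [hR, Multiset.mem_toFinset, Polynomial.mem_nthRoots hk]
  have card_R : R.card = k := by
    rw [hR, Multiset.toFinset_card_of_nodup (hζ.nthRoots_nodup hp), hζ.card_nthRoots,
      if_pos (IsAlgClosed.exists_pow_nat_eq p hk)]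
  have h1 : rootsNe k p = (R.filter fun u => ¬u ∈ ({1, -1} : Finset ℂ) : Finset ℂ) := by
    ext u
    simp [rootsNe, mem_R]
  have h2 : (R.filter fun u => u ∈ ({1, -1} : Finset ℂ)) =
      ({1, -1} : Finset ℂ).filter fun u => u ^ k = p := by
    ext u
    simp only [Finset.mem_filter, mem_R]
    exact and_comm
  have h3 := Finset.card_filter_add_card_filter_not (s := R) fun u => u ∈ ({1, -1} : Finset ℂ)
  rw [h2, card_R, Finset.card_filter, Finset.sum_pair (by norm_num), one_pow] at h3
  rw [h1, Set.ncard_coe_finset]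
  have h4 := congrArg (Nat.cast : ℕ → ℚ) h3
  push_cast at h4
  linarith

theorem ite_add_ite {P Q : Prop} [Decidable P] [Decidable Q] (hPQ : ¬(P ∧ Q)) :
    ((if P then 1 else 0) + (if Q then 1 else 0) : ℚ) = if P ∨ Q then 1 else 0 := by
  by_cases hP : P <;> by_cases hQ : Q <;> simp_all

/-- Multiplying the two conditions gives (u^m')² = ab, so u^m' = ±p and v^n' = ±p/a for a square
root p of ab. For each sign, count the roots and discard 1 and −1; one of these is a root for some
sign only if ab = 1 (for u) or a = b (for v). -/
theorem ncard_pairs_fiber {d m' n' : ℕ} (hd : 0 < d) (hm' : 0 < m') (hn' : 0 < n')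
    (hcop : m'.Coprime n') {a b : ℂ} (ha : a ^ d = 1) (hb : b ^ d = 1) :
    ({q ∈ pairs (m' * d) (n' * d) | q.1 ^ m' * (q.2 ^ n')⁻¹ = a ∧ q.1 ^ m' * q.2 ^ n' = b}.ncard
      : ℚ) = 2 * (m' - if a * b = 1 then 1 else 0) * (n' - if a = b then 1 else 0) := by
  have ha0 : a ≠ 0 := by
    rintro rfl
    simp [hd.ne'] at ha
  have hb0 : b ≠ 0 := by
    rintro rfl
    simp [hd.ne'] at hb
  obtain ⟨p, hp⟩ := IsAlgClosed.exists_pow_nat_eq (a * b) (n := 2) (by norm_num)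
  have hp0 : p ≠ 0 := by
    rintro rfl
    rw [zero_pow two_ne_zero] at hp
    exact mul_ne_zero ha0 hb0 hp.symm
  have hset : {q ∈ pairs (m' * d) (n' * d) |
      q.1 ^ m' * (q.2 ^ n')⁻¹ = a ∧ q.1 ^ m' * q.2 ^ n' = b} =
      rootsNe m' p ×ˢ rootsNe n' (p / a) ∪ rootsNe m' (-p) ×ˢ rootsNe n' (-p / a) := by
    ext ⟨u, v⟩
    simp only [pairs, rootsNe, Set.mem_ofPred_eq, Set.mem_union, Set.mem_prod]
    constructor
    · rintro ⟨⟨h1, h2, h3, h4⟩, h5, h6⟩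
      have hv : v ^ n' ≠ 0 := by
        intro e
        rw [e, mul_zero] at h6
        exact hb0 h6.symm
      have h7 : v ^ n' = u ^ m' / a := by
        rw [← h5]
        have hu : u ^ m' ≠ 0 := by
          intro e
          rw [e, zero_mul] at h6
          exact hb0 h6.symm
        field_simp
      have h8 : (u ^ m') ^ 2 = p ^ 2 := by
        rw [hp, ← h5, ← h6]
        field_simp
      rcases sq_eq_sq_iff_eq_or_eq_neg.1 h8 with e | e
      · exact .inl ⟨⟨e, h1⟩, e ▸ h7, h2⟩
      · exact .inr ⟨⟨e, h1⟩, e ▸ h7, h2⟩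
    · intro h
      have h' : ∃ r : ℂ, r ^ 2 = a * b ∧ u ^ m' = r ∧ v ^ n' = r / a ∧ (u ≠ 1 ∧ u ≠ -1) ∧
          (v ≠ 1 ∧ v ≠ -1) := by
        rcases h with ⟨⟨h1, h2⟩, h3, h4⟩ | ⟨⟨h1, h2⟩, h3, h4⟩
        · exact ⟨p, hp, h1, h3, h2, h4⟩
        · exact ⟨-p, by rw [neg_sq, hp], h1, h3, h2, h4⟩
      obtain ⟨r, hr, h1, h2, h3, h4⟩ := h'
      have hr0 : r ≠ 0 := by
        rintro rfl
        rw [zero_pow two_ne_zero] at hr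
        exact mul_ne_zero ha0 hb0 hr.symm
      refine ⟨⟨h3, h4, ?_, ?_⟩, ?_, ?_⟩
      · rw [pow_mul, pow_mul, h1, h2, div_pow, ha, div_one]
      · rw [pow_mul, pow_mul, h1, h2, ← mul_pow, ← mul_div_assoc, ← sq, hr,
          mul_div_cancel_left₀ _ ha0, hb]
      · rw [h1, h2]
        field_simp
      · rw [h1, h2, ← mul_div_assoc, ← sq, hr, mul_div_cancel_left₀ _ ha0]
  have hdisj : Disjoint (rootsNe m' p ×ˢ rootsNe n' (p / a))
      (rootsNe m' (-p) ×ˢ rootsNe n' (-p / a)) := by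
    rw [Set.disjoint_left]
    rintro ⟨u, v⟩ ⟨⟨h1, -⟩, -⟩ ⟨⟨h2, -⟩, -⟩
    exact hp0 (self_eq_neg.1 (h1.symm.trans h2))
  rw [hset, Set.ncard_union_eq hdisj
    ((finite_rootsNe hm' _).prod (finite_rootsNe hn' _))
    ((finite_rootsNe hm' _).prod (finite_rootsNe hn' _)), Set.ncard_prod, Set.ncard_prod]
  push_cast
  rw [ncard_rootsNe hm' hp0, ncard_rootsNe hn' (div_ne_zero hp0 ha0),
    ncard_rootsNe hm' (neg_ne_zero.2 hp0), ncard_rootsNe hn' (div_ne_zero (neg_ne_zero.2 hp0) ha0)]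
  have c1 : (1 : ℂ) = p / a ↔ a = p := by rw [eq_div_iff ha0, one_mul]
  have c2 : (1 : ℂ) = -p / a ↔ a = -p := by rw [eq_div_iff ha0, one_mul]
  have c3 : (-1 : ℂ) = p / a ↔ a = -p := by
    rw [eq_div_iff ha0, neg_one_mul, neg_eq_iff_eq_neg]
  have c4 : (-1 : ℂ) = -p / a ↔ a = p := by
    rw [eq_div_iff ha0, neg_one_mul, neg_inj]
  have c5 : (-1 : ℂ) = p ↔ (1 : ℂ) = -p := neg_eq_iff_eq_neg
  have c6 : (-1 : ℂ) = -p ↔ (1 : ℂ) = p := neg_inj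
  have e1 : ((if (1 : ℂ) = p then 1 else 0) + (if (1 : ℂ) = -p then 1 else 0) : ℚ) =
      if a * b = 1 then 1 else 0 := by
    have h1 : a * b = 1 ↔ 1 = p ∨ 1 = -p := by
      rw [← hp, ← sq_eq_sq_iff_eq_or_eq_neg, one_pow, eq_comm]
    have h2 : ¬(1 = p ∧ 1 = -p) := fun e => hp0 (self_eq_neg.1 (e.1.symm.trans e.2))
    simp only [h1]
    exact ite_add_ite h2
  have e2 : ((if a = p then 1 else 0) + (if a = -p then 1 else 0) : ℚ) =
      if a = b then 1 else 0 := by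
    have h1 : a = b ↔ a = p ∨ a = -p := by
      rw [← sq_eq_sq_iff_eq_or_eq_neg, hp, sq, mul_right_inj' ha0]
    have h2 : ¬(a = p ∧ a = -p) := fun e => hp0 (self_eq_neg.1 (e.1.symm.trans e.2))
    simp only [h1]
    exact ite_add_ite h2
  rw [← e1, ← e2]
  rcases Nat.even_or_odd m' with hm | hm <;> rcases Nat.even_or_odd n' with hn | hn
  -- Coprimality excludes two even exponents. An odd exponent gives the same count for both signs,
  -- so the sum over signs factors as claimed; with both even, extra cross terms could remain.
  · have := Nat.dvd_gcd hm.two_dvd hn.two_dvd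
    rw [hcop.gcd_eq_one] at this
    norm_num at this
  all_goals
    simp only [hm.neg_one_pow, hn.neg_one_pow, c1, c2, c3, c4, c5, c6]
    ring

/-! ### Summation over pairs of exponents -/

/-- The exponent of the inverse of `ζ ^ i`. -/
def negExp (d i : ℕ) : ℕ := if i = 0 then 0 else d - i

theorem negExp_lt {d i : ℕ} (hi : i < d) : negExp d i < d := by
  rw [negExp]
  split_ifs <;> omega

theorem negExp_negExp {d i : ℕ} (hi : i < d) : negExp d (negExp d i) = i := by
  rw [negExp, negExp]
  split_ifs <;> omega

theorem eq_negExp_iff {d i j : ℕ} (hi : i < d) (hj : j < d) :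
    j = negExp d i ↔ i = 0 ∧ j = 0 ∨ i + j = d := by
  rw [negExp]
  split_ifs <;> omega

theorem pow_mul_pow_eq_one_iff {d : ℕ} {ζ : ℂ} (hζ : IsPrimitiveRoot ζ d) {i j : ℕ} (hi : i < d)
    (hj : j < d) : ζ ^ i * ζ ^ j = 1 ↔ j = negExp d i := by
  rw [← pow_add, hζ.pow_eq_one_iff_dvd, eq_negExp_iff hi hj]
  constructor
  · rintro ⟨k, hk⟩
    -- As i + j < 2d, only the multiples 0 and d are possible.
    have : k < 2 := by
      by_contra! hk2
      have := Nat.mul_le_mul_left d hk2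
      omega
    interval_cases k <;> omega
  · rintro (⟨rfl, rfl⟩ | h)
    · simp
    · rw [h]

theorem C_pow_eq_iff {d m' n' : ℕ} (hd : 0 < d) (hm' : 0 < m') {ζ : ℂ}
    (hζ : IsPrimitiveRoot ζ d) {i j : ℕ} (hi : i < d) (hj : j < d) :
    C m' n' (ζ ^ i) = C m' n' (ζ ^ j) ↔ j = i ∨ j = negExp d i := by
  have h0 : ζ ≠ 0 := hζ.ne_zero hd.ne'
  rw [C_eq_iff hm' (pow_ne_zero _ h0) (pow_ne_zero _ h0),
    ← mul_eq_one_iff_eq_inv₀ (pow_ne_zero _ h0), pow_mul_pow_eq_one_iff hζ hi hj]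
  exact or_congr_left ⟨fun e => (hζ.pow_inj hi hj e).symm, fun e => by rw [e]⟩

/-- Half the number of pairs of eigenvalues `(u, v)` with `u ^ m' * (v ^ n')⁻¹ = ζ ^ i` and
`u ^ m' * v ^ n' = ζ ^ j`. -/
def weight (d m' n' i j : ℕ) : ℚ :=
  (m' - if j = negExp d i then 1 else 0) * (n' - if j = i then 1 else 0)

/-- The admissible pairs are partitioned by the exponents of a and b, and `hR` says that R depends
only on these. A line has four pairs while a cell (i, j) has twice its `weight`, which leaves the
factor 2. -/
theorem two_mul_ncard_lines {d m' n' : ℕ} (hd : 0 < d) (hm' : 0 < m') (hn' : 0 < n')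
    (hcop : m'.Coprime n') {ζ : ℂ} (hζ : IsPrimitiveRoot ζ d) (R : Set (Fin 3 → ℂ) → Prop)
    (S : Finset (ℕ × ℕ)) (hS : S ⊆ Finset.range d ×ˢ Finset.range d)
    (hR : ∀ u v : ℂ, u ≠ 0 → v ≠ 0 → pt u v ≠ pt u v⁻¹ → ∀ i < d, ∀ j < d,
      u ^ m' * (v ^ n')⁻¹ = ζ ^ i → u ^ m' * v ^ n' = ζ ^ j → (R (lineOf (u, v)) ↔ (i, j) ∈ S)) :
    2 * ({L ∈ lines (m' * d) (n' * d) | R L}.ncard : ℚ) =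
      ∑ x ∈ S, weight d m' n' x.1 x.2 := by
  have : NeZero d := ⟨hd.ne'⟩
  have hm : 0 < m' * d := by positivity
  have hn : 0 < n' * d := by positivity
  have hfin := finite_pairs hm hn
  let A : ℕ × ℕ → Set (ℂ × ℂ) := fun x => {q ∈ pairs (m' * d) (n' * d) |
    q.1 ^ m' * (q.2 ^ n')⁻¹ = ζ ^ x.1 ∧ q.1 ^ m' * q.2 ^ n' = ζ ^ x.2}
  have hA (x) : (A x).Finite := hfin.subset (Set.sep_subset _ _)
  have hex (q) (hq : q ∈ pairs (m' * d) (n' * d)) : ∃ i < d, ∃ j < d, q ∈ A (i, j) := by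
    obtain ⟨hu, hv⟩ := pairs_ne_zero hm hn hq
    have hq' := hq
    obtain ⟨-, -, h3, h4⟩ := hq'
    obtain ⟨i, hi, h1⟩ := hζ.eq_pow_of_pow_eq_one (ξ := q.1 ^ m' * (q.2 ^ n')⁻¹) (by
      rw [mul_pow, inv_pow, ← pow_mul, ← pow_mul, h3, mul_inv_cancel₀ (pow_ne_zero _ hv)])
    obtain ⟨j, hj, h2⟩ := hζ.eq_pow_of_pow_eq_one (ξ := q.1 ^ m' * q.2 ^ n') (by
      rw [mul_pow, ← pow_mul, ← pow_mul, h4])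
    exact ⟨i, hi, j, hj, hq, h1.symm, h2.symm⟩
  have hRA (q) (i) (hi : i < d) (j) (hj : j < d) (hq : q ∈ A (i, j)) :
      R (lineOf q) ↔ (i, j) ∈ S := by
    obtain ⟨hq, h1, h2⟩ := hq
    obtain ⟨hu, hv⟩ := pairs_ne_zero hm hn hq
    exact hR q.1 q.2 hu hv (pt_ne_pt_inv hu hv hq.1 hq.2.1) i hi j hj h1 h2
  have hset : {q ∈ pairs (m' * d) (n' * d) | R (lineOf q)} =
      (S.biUnion fun x => (hA x).toFinset : Finset (ℂ × ℂ)) := by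
    ext q
    simp only [Finset.coe_biUnion, Set.Finite.coe_toFinset, Set.mem_iUnion, exists_prop,
      SetLike.mem_coe]
    constructor
    · rintro ⟨hq, h⟩
      obtain ⟨i, hi, j, hj, hA⟩ := hex q hq
      exact ⟨(i, j), (hRA q i hi j hj hA).1 h, hA⟩
    · rintro ⟨⟨i, j⟩, hx, hA⟩
      have := hS hx
      rw [Finset.mem_product, Finset.mem_range, Finset.mem_range] at this
      exact ⟨hA.1, (hRA q i this.1 j this.2 hA).2 hx⟩
  have hdisj : (S : Set (ℕ × ℕ)).PairwiseDisjoint fun x => (hA x).toFinset := by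
    rintro ⟨i, j⟩ hx ⟨i', j'⟩ hy hne
    have hx' := hS hx
    have hy' := hS hy
    simp only [Finset.mem_product, Finset.mem_range] at hx' hy'
    refine Finset.disjoint_left.2 fun q hq hq' => hne ?_
    rw [Set.Finite.mem_toFinset] at hq hq'
    rw [hζ.pow_inj hx'.1 hy'.1 (hq.2.1.symm.trans hq'.2.1),
      hζ.pow_inj hx'.2 hy'.2 (hq.2.2.symm.trans hq'.2.2)]
  have h4 := congrArg (Nat.cast : ℕ → ℚ) (four_mul_ncard_lines hm hn R)
  rw [hset, Set.ncard_coe_finset, Finset.card_biUnion hdisj] at h4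
  push_cast at h4
  have key : ∑ x ∈ S, ((hA x).toFinset.card : ℚ) = ∑ x ∈ S, 2 * weight d m' n' x.1 x.2 := by
    refine Finset.sum_congr rfl fun x hx => ?_
    have hx' := hS hx
    simp only [Finset.mem_product, Finset.mem_range] at hx'
    have hpow (i : ℕ) : (ζ ^ i) ^ d = 1 := by
      rw [← pow_mul, mul_comm, pow_mul, hζ.pow_eq_one, one_pow]
    rw [← Set.ncard_eq_toFinset_card (A x) (hA x),
      ncard_pairs_fiber hd hm' hn' hcop (hpow x.1) (hpow x.2), weight, mul_assoc]
    have e1 := pow_mul_pow_eq_one_iff hζ hx'.1 hx'.2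
    have e2 : ζ ^ x.1 = ζ ^ x.2 ↔ x.2 = x.1 :=
      ⟨fun e => (hζ.pow_inj hx'.1 hx'.2 e).symm, fun e => by rw [e]⟩
    simp only [e1, e2]
  rw [key, ← Finset.mul_sum] at h4
  linarith

/-- The exponents of `ζ ^ i` and of its inverse. -/
def cls (d i : ℕ) : Finset ℕ := {i, negExp d i}

/-- The exponents `i < d` for which `ζ ^ i` is not its own inverse. -/
def nonSelfInv (d : ℕ) : Finset ℕ := (Finset.range d).filter fun i => negExp d i ≠ i

theorem mem_cls {d i j : ℕ} : j ∈ cls d i ↔ j = i ∨ j = negExp d i := by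
  simp [cls]

theorem lt_of_mem_cls {d i j : ℕ} (hi : i < d) (hj : j ∈ cls d i) : j < d := by
  rcases mem_cls.1 hj with rfl | rfl
  exacts [hi, negExp_lt hi]

theorem cls_subset {d i : ℕ} (hi : i < d) : cls d i ⊆ Finset.range d := fun _ hj =>
  Finset.mem_range.2 (lt_of_mem_cls hi hj)

theorem cls_eq_of_mem {d i j : ℕ} (hi : i < d) (hj : j ∈ cls d i) : cls d j = cls d i := by
  rcases mem_cls.1 hj with rfl | rfl
  · rfl
  · rw [cls, cls, negExp_negExp hi, Finset.pair_comm]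

theorem self_mem_cls (d i : ℕ) : i ∈ cls d i := mem_cls.2 (.inl rfl)

theorem mem_cls_comm {d i j : ℕ} (hi : i < d) (hj : j < d) : j ∈ cls d i ↔ i ∈ cls d j :=
  ⟨fun h => cls_eq_of_mem hi h ▸ self_mem_cls d i, fun h => cls_eq_of_mem hj h ▸ self_mem_cls d j⟩

theorem cls_of_eq {d i : ℕ} (h : negExp d i = i) : cls d i = {i} := by
  rw [cls, h, Finset.pair_eq_singleton]

theorem card_cls_of_eq {d i : ℕ} (h : negExp d i = i) : (cls d i).card = 1 := by
  rw [cls_of_eq h, Finset.card_singleton]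

theorem card_cls_of_ne {d i : ℕ} (h : negExp d i ≠ i) : (cls d i).card = 2 := by
  rw [cls, Finset.card_pair h.symm]

theorem mem_nonSelfInv {d i : ℕ} : i ∈ nonSelfInv d ↔ i < d ∧ negExp d i ≠ i := by
  simp [nonSelfInv]

theorem mem_nonSelfInv_of_mem_cls {d i j : ℕ} (hi : i ∈ nonSelfInv d) (hj : j ∈ cls d i) :
    j ∈ nonSelfInv d := by
  rw [mem_nonSelfInv] at hi ⊢
  refine ⟨lt_of_mem_cls hi.1 hj, ?_⟩
  rcases mem_cls.1 hj with rfl | rfl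
  · exact hi.2
  · rw [negExp_negExp hi.1]
    exact hi.2.symm

theorem weight_of_notMem {d m' n' i j : ℕ} (h : j ∉ cls d i) : weight d m' n' i j = m' * n' := by
  rw [mem_cls, not_or] at h
  rw [weight, if_neg h.1, if_neg h.2, sub_zero, sub_zero]

theorem sum_weight_cls_of_ne {d m' n' i : ℕ} (h : negExp d i ≠ i) :
    ∑ j ∈ cls d i, weight d m' n' i j = (m' - 1) * n' + m' * (n' - 1) := by
  rw [cls, Finset.sum_pair h.symm, weight, weight, if_neg h.symm, if_pos rfl, if_pos rfl, if_neg h]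
  ring

theorem sum_weight_range {d m' n' i : ℕ} (hi : i < d) :
    ∑ j ∈ Finset.range d, weight d m' n' i j =
      d * m' * n' - m' - n' + if negExp d i = i then 1 else 0 := by
  -- Expanding the product, the two indicators overlap only at j = i, and only when i is its own
  -- negative.
  have e (j : ℕ) : weight d m' n' i j = m' * n' - (if j = i then (m' : ℚ) else 0) -
      (if j = negExp d i then (n' : ℚ) else 0) +
        if j = i then (if negExp d i = i then 1 else 0) else 0 := by
    rw [weight]
    split_ifs <;> first | omega | ring
  simp only [e, Finset.sum_add_distrib, Finset.sum_sub_distrib, Finset.sum_ite_eq',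
    Finset.mem_range, hi, negExp_lt hi, if_true, Finset.sum_const, Finset.card_range, nsmul_eq_mul]
  ring

/-! ### Counts of lines by the curves they meet -/

section Counting

variable {d m' n' : ℕ} {ζ : ℂ}

theorem meetsTwice_iff_mem_cls (hd : 0 < d) (hm' : 0 < m') (hζ : IsPrimitiveRoot ζ d) {u v : ℂ}
    (hu : u ≠ 0) (hv : v ≠ 0) (hne : pt u v ≠ pt u v⁻¹) {a b i : ℕ} (ha : a < d) (hb : b < d)
    (hi : i < d) (h1 : u ^ m' * (v ^ n')⁻¹ = ζ ^ a) (h2 : u ^ m' * v ^ n' = ζ ^ b) :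
    MeetsTwice (lineOf (u, v)) (C m' n' (ζ ^ i)) ↔ a ∈ cls d i ∧ b ∈ cls d i := by
  rw [meetsTwice_lineOf_iff hu hv (pow_ne_zero _ (hζ.ne_zero hd.ne')) hne, h1, h2,
    C_pow_eq_iff hd hm' hζ ha hi, C_pow_eq_iff hd hm' hζ hb hi, ← mem_cls, ← mem_cls,
    mem_cls_comm ha hi, mem_cls_comm hb hi]

theorem meetsPair_iff_mem_cls (hd : 0 < d) (hm' : 0 < m') (hζ : IsPrimitiveRoot ζ d) {u v : ℂ}
    (hu : u ≠ 0) (hv : v ≠ 0) (hne : pt u v ≠ pt u v⁻¹) {a b i j : ℕ} (ha : a < d) (hb : b < d)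
    (hi : i < d) (hj : j < d) (hij : j ∉ cls d i)
    (h1 : u ^ m' * (v ^ n')⁻¹ = ζ ^ a) (h2 : u ^ m' * v ^ n' = ζ ^ b) :
    MeetsPair (lineOf (u, v)) (C m' n' (ζ ^ i)) (C m' n' (ζ ^ j)) ↔
      (a ∈ cls d i ∧ b ∈ cls d j) ∨ (a ∈ cls d j ∧ b ∈ cls d i) := by
  have h0 := hζ.ne_zero hd.ne'
  rw [meetsPair_lineOf_iff hu hv (pow_ne_zero _ h0) (pow_ne_zero _ h0) hne
    (by rwa [Ne, C_pow_eq_iff hd hm' hζ hi hj, ← mem_cls]), h1, h2,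
    C_pow_eq_iff hd hm' hζ ha hi, C_pow_eq_iff hd hm' hζ hb hi, C_pow_eq_iff hd hm' hζ ha hj,
    C_pow_eq_iff hd hm' hζ hb hj, ← mem_cls, ← mem_cls, ← mem_cls, ← mem_cls,
    mem_cls_comm ha hi, mem_cls_comm hb hi, mem_cls_comm ha hj, mem_cls_comm hb hj]

/-- Both exponents range over the class of i; the inner sum is written over the class of a, which is
the same set, so that `sum_weight_cls_of_ne` applies. -/
theorem two_mul_ncard_meetsTwice (hd : 0 < d) (hm' : 0 < m') (hn' : 0 < n')
    (hcop : m'.Coprime n') (hζ : IsPrimitiveRoot ζ d) {i : ℕ} (hi : i < d) :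
    2 * ({L ∈ lines (m' * d) (n' * d) | MeetsTwice L (C m' n' (ζ ^ i))}.ncard : ℚ) =
      ∑ a ∈ cls d i, ∑ b ∈ cls d a, weight d m' n' a b := by
  rw [two_mul_ncard_lines hd hm' hn' hcop hζ _ (cls d i ×ˢ cls d i)
    (Finset.product_subset_product (cls_subset hi) (cls_subset hi)), Finset.sum_product]
  · exact Finset.sum_congr rfl fun a ha => by rw [cls_eq_of_mem hi ha]
  · intro u v hu hv hne a ha b hb h1 h2
    rw [meetsTwice_iff_mem_cls hd hm' hζ hu hv hne ha hb hi h1 h2, Finset.mem_product]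

theorem ncard_meetsTwice_of_eq (hd : 0 < d) (hm' : 0 < m') (hn' : 0 < n')
    (hcop : m'.Coprime n') (hζ : IsPrimitiveRoot ζ d) {i : ℕ} (hi : i < d)
    (h : negExp d i = i) :
    ({L ∈ lines (m' * d) (n' * d) | MeetsTwice L (C m' n' (ζ ^ i))}.ncard : ℚ) =
      (m' - 1) * (n' - 1) / 2 := by
  have := two_mul_ncard_meetsTwice hd hm' hn' hcop hζ hi
  rw [cls_of_eq h, Finset.sum_singleton, cls_of_eq h, Finset.sum_singleton, weight, if_pos h.symm,
    if_pos rfl] at this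
  linarith

theorem ncard_meetsTwice_of_ne (hd : 0 < d) (hm' : 0 < m') (hn' : 0 < n')
    (hcop : m'.Coprime n') (hζ : IsPrimitiveRoot ζ d) {i : ℕ} (hi : i ∈ nonSelfInv d) :
    ({L ∈ lines (m' * d) (n' * d) | MeetsTwice L (C m' n' (ζ ^ i))}.ncard : ℚ) =
      (m' - 1) * n' + m' * (n' - 1) := by
  have hi' := mem_nonSelfInv.1 hi
  have := two_mul_ncard_meetsTwice hd hm' hn' hcop hζ hi'.1
  rw [Finset.sum_congr rfl fun a ha => sum_weight_cls_of_ne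
    (mem_nonSelfInv.1 (mem_nonSelfInv_of_mem_cls hi ha)).2, Finset.sum_const,
    card_cls_of_ne hi'.2, nsmul_eq_mul] at this
  push_cast at this
  linarith

/-- The two exponents lie in different classes, in either order. Both indicators in `weight` then
vanish, and the two orders cancel the factor 2. -/
theorem ncard_meetsPair (hd : 0 < d) (hm' : 0 < m') (hn' : 0 < n')
    (hcop : m'.Coprime n') (hζ : IsPrimitiveRoot ζ d) {i j : ℕ} (hi : i < d) (hj : j < d)
    (hij : j ∉ cls d i) :
    {L ∈ lines (m' * d) (n' * d) | MeetsPair L (C m' n' (ζ ^ i)) (C m' n' (ζ ^ j))}.ncard =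
      (cls d i).card * (cls d j).card * m' * n' := by
  have hS := two_mul_ncard_lines hd hm' hn' hcop hζ
    (fun L => MeetsPair L (C m' n' (ζ ^ i)) (C m' n' (ζ ^ j)))
    (cls d i ×ˢ cls d j ∪ cls d j ×ˢ cls d i)
    (Finset.union_subset (Finset.product_subset_product (cls_subset hi) (cls_subset hj))
      (Finset.product_subset_product (cls_subset hj) (cls_subset hi)))
    (by
      intro u v hu hv hne a ha b hb h1 h2
      rw [meetsPair_iff_mem_cls hd hm' hζ hu hv hne ha hb hi hj hij h1 h2, Finset.mem_union,
        Finset.mem_product, Finset.mem_product])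
  have hdisj : ∀ {a}, a ∈ cls d i → a ∉ cls d j := fun {a} h1 h2 =>
    hij (by rw [← cls_eq_of_mem hi h1, cls_eq_of_mem hj h2]; exact self_mem_cls d j)
  have hw : ∀ x ∈ cls d i ×ˢ cls d j ∪ cls d j ×ˢ cls d i,
      weight d m' n' x.1 x.2 = m' * n' := by
    intro x hx
    apply weight_of_notMem
    intro h
    rw [Finset.mem_union, Finset.mem_product, Finset.mem_product] at hx
    rcases hx with ⟨h1, h2⟩ | ⟨h1, h2⟩
    · rw [cls_eq_of_mem hi h1] at h
      exact hdisj h h2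
    · rw [cls_eq_of_mem hj h1] at h
      exact hdisj h2 h
  have hd' : Disjoint (cls d i ×ˢ cls d j) (cls d j ×ˢ cls d i) := by
    rw [Finset.disjoint_left]
    intro x hx hy
    exact hdisj (Finset.mem_product.1 hx).1 (Finset.mem_product.1 hy).1
  rw [Finset.sum_congr rfl hw, Finset.sum_const, Finset.card_union_of_disjoint hd',
    Finset.card_product, Finset.card_product, nsmul_eq_mul] at hS
  have : (2 * {L ∈ lines (m' * d) (n' * d) |
      MeetsPair L (C m' n' (ζ ^ i)) (C m' n' (ζ ^ j))}.ncard : ℕ) =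
      2 * ((cls d i).card * (cls d j).card * m' * n') := by
    apply Nat.cast_injective (R := ℚ)
    push_cast at hS ⊢
    rw [hS]
    ring
  omega

/-- Every row indexed by a non-self-inverse exponent has the same sum. Two exponents give one curve,
so half the cardinality is the number of curves. -/
theorem ncard_exists_meetsTwice (hd : 0 < d) (hm' : 0 < m') (hn' : 0 < n')
    (hcop : m'.Coprime n') (hζ : IsPrimitiveRoot ζ d) :
    ({L ∈ lines (m' * d) (n' * d) |
      ∃ i ∈ nonSelfInv d, MeetsTwice L (C m' n' (ζ ^ i))}.ncard : ℚ) =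
      (nonSelfInv d).card / 2 * ((m' - 1) * n' + m' * (n' - 1)) := by
  have hS := two_mul_ncard_lines hd hm' hn' hcop hζ
    (fun L => ∃ i ∈ nonSelfInv d, MeetsTwice L (C m' n' (ζ ^ i)))
    ((Finset.range d ×ˢ Finset.range d).filter fun x => x.1 ∈ nonSelfInv d ∧ x.2 ∈ cls d x.1)
    (Finset.filter_subset _ _)
    (by
      intro u v hu hv hne a ha b hb h1 h2
      simp only [Finset.mem_filter, Finset.mem_product, Finset.mem_range, ha, hb, true_and]
      constructor
      · rintro ⟨i, hi, h⟩
        have hi' := (mem_nonSelfInv.1 hi).1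
        rw [meetsTwice_iff_mem_cls hd hm' hζ hu hv hne ha hb hi' h1 h2] at h
        exact ⟨mem_nonSelfInv_of_mem_cls hi h.1, cls_eq_of_mem hi' h.1 ▸ h.2⟩
      · rintro ⟨h3, h4⟩
        exact ⟨a, h3, (meetsTwice_iff_mem_cls hd hm' hζ hu hv hne ha hb ha h1 h2).2
          ⟨self_mem_cls d a, h4⟩⟩)
  rw [Finset.sum_finset_product _ (nonSelfInv d) (cls d) (by
    intro x
    simp only [Finset.mem_filter, Finset.mem_product, Finset.mem_range, and_iff_right_iff_imp]
    rintro ⟨h1, h2⟩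
    have := (mem_nonSelfInv.1 h1).1
    exact ⟨this, lt_of_mem_cls this h2⟩),
    Finset.sum_congr rfl fun a ha => sum_weight_cls_of_ne (mem_nonSelfInv.1 ha).2,
    Finset.sum_const, nsmul_eq_mul] at hS
  linarith

theorem ncard_exists_meetsPair_of_eq (hd : 0 < d) (hm' : 0 < m') (hn' : 0 < n')
    (hcop : m'.Coprime n') (hζ : IsPrimitiveRoot ζ d) {z : ℕ} (hz : z < d)
    (h : negExp d z = z) :
    ({L ∈ lines (m' * d) (n' * d) |
      ∃ i ∈ nonSelfInv d, MeetsPair L (C m' n' (ζ ^ z)) (C m' n' (ζ ^ i))}.ncard : ℚ) =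
      (nonSelfInv d).card / 2 * (2 * m' * n') := by
  have hzI : z ∉ nonSelfInv d := fun hz => (mem_nonSelfInv.1 hz).2 h
  have hsub : nonSelfInv d ⊆ Finset.range d := Finset.filter_subset _ _
  have hsub' : {z} ⊆ Finset.range d := by simpa using hz
  have hS := two_mul_ncard_lines hd hm' hn' hcop hζ
    (fun L => ∃ i ∈ nonSelfInv d, MeetsPair L (C m' n' (ζ ^ z)) (C m' n' (ζ ^ i)))
    ({z} ×ˢ nonSelfInv d ∪ nonSelfInv d ×ˢ {z})
    (Finset.union_subset (Finset.product_subset_product hsub' hsub)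
      (Finset.product_subset_product hsub hsub'))
    (by
      intro u v hu hv hne a ha b hb h1 h2
      have key (i) (hi : i ∈ nonSelfInv d) := meetsPair_iff_mem_cls hd hm' hζ hu hv hne ha hb hz
        (mem_nonSelfInv.1 hi).1 (by
          rw [cls_of_eq h, Finset.mem_singleton]
          rintro rfl
          exact hzI hi) h1 h2
      rw [Finset.mem_union, Finset.mem_product, Finset.mem_product]
      constructor
      · rintro ⟨i, hi, hP⟩
        rw [key i hi, cls_of_eq h] at hP
        exact hP.imp (fun hP => ⟨hP.1, mem_nonSelfInv_of_mem_cls hi hP.2⟩)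
          fun hP => ⟨mem_nonSelfInv_of_mem_cls hi hP.1, hP.2⟩
      · rintro (⟨h3, h4⟩ | ⟨h3, h4⟩)
        · refine ⟨b, h4, (key b h4).2 (.inl ⟨?_, self_mem_cls d b⟩)⟩
          rwa [cls_of_eq h]
        · refine ⟨a, h3, (key a h3).2 (.inr ⟨self_mem_cls d a, ?_⟩)⟩
          rwa [cls_of_eq h])
  have hw : ∀ x ∈ {z} ×ˢ nonSelfInv d ∪ nonSelfInv d ×ˢ {z},
      weight d m' n' x.1 x.2 = m' * n' := by
    intro x hx
    apply weight_of_notMem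
    intro h'
    rw [Finset.mem_union, Finset.mem_product, Finset.mem_product, Finset.mem_singleton,
      Finset.mem_singleton] at hx
    rcases hx with ⟨h1, h2⟩ | ⟨h1, h2⟩
    · rw [h1, cls_of_eq h, Finset.mem_singleton] at h'
      exact hzI (h' ▸ h2)
    · exact hzI (h2 ▸ mem_nonSelfInv_of_mem_cls h1 h')
  have hd' : Disjoint ({z} ×ˢ nonSelfInv d) (nonSelfInv d ×ˢ {z}) := by
    rw [Finset.disjoint_left]
    intro x hx hy
    have := (Finset.mem_product.1 hx).1
    rw [Finset.mem_singleton] at this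
    exact hzI (this ▸ (Finset.mem_product.1 hy).1)
  rw [Finset.sum_congr rfl hw, Finset.sum_const, Finset.card_union_of_disjoint hd',
    Finset.card_product, Finset.card_product, Finset.card_singleton, nsmul_eq_mul] at hS
  push_cast at hS
  linarith

/-- Given the first exponent, the second avoids a class of two elements; every remaining cell has
weight m'n'. -/
theorem two_mul_ncard_exists_meetsPair (hd : 0 < d) (hm' : 0 < m') (hn' : 0 < n')
    (hcop : m'.Coprime n') (hζ : IsPrimitiveRoot ζ d) :
    2 * ({L ∈ lines (m' * d) (n' * d) | ∃ i ∈ nonSelfInv d, ∃ j ∈ nonSelfInv d,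
      C m' n' (ζ ^ i) ≠ C m' n' (ζ ^ j) ∧
        MeetsPair L (C m' n' (ζ ^ i)) (C m' n' (ζ ^ j))}.ncard : ℚ) =
      (nonSelfInv d).card * ((nonSelfInv d).card - 2) * (m' * n') := by
  have hsub : nonSelfInv d ⊆ Finset.range d := Finset.filter_subset _ _
  have hcls (a) (ha : a ∈ nonSelfInv d) : cls d a ⊆ nonSelfInv d := fun _ hb =>
    mem_nonSelfInv_of_mem_cls ha hb
  have hS := two_mul_ncard_lines hd hm' hn' hcop hζ
    (fun L => ∃ i ∈ nonSelfInv d, ∃ j ∈ nonSelfInv d, C m' n' (ζ ^ i) ≠ C m' n' (ζ ^ j) ∧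
        MeetsPair L (C m' n' (ζ ^ i)) (C m' n' (ζ ^ j)))
    ((nonSelfInv d ×ˢ nonSelfInv d).filter fun x => x.2 ∉ cls d x.1)
    ((Finset.filter_subset _ _).trans (Finset.product_subset_product hsub hsub))
    (by
      intro u v hu hv hne a ha b hb h1 h2
      rw [Finset.mem_filter, Finset.mem_product]
      constructor
      · rintro ⟨i, hi, j, hj, hC, hP⟩
        have hi' := (mem_nonSelfInv.1 hi).1
        have hj' := (mem_nonSelfInv.1 hj).1
        rw [Ne, C_pow_eq_iff hd hm' hζ hi' hj', ← mem_cls] at hC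
        rw [meetsPair_iff_mem_cls hd hm' hζ hu hv hne ha hb hi' hj' hC h1 h2] at hP
        rcases hP with ⟨h3, h4⟩ | ⟨h3, h4⟩
        · refine ⟨⟨hcls i hi h3, hcls j hj h4⟩, fun h5 => hC ?_⟩
          rw [cls_eq_of_mem hi' h3] at h5
          rw [← cls_eq_of_mem hi' h5, cls_eq_of_mem hj' h4]
          exact self_mem_cls d j
        · refine ⟨⟨hcls j hj h3, hcls i hi h4⟩, fun h5 => hC ?_⟩
          rw [cls_eq_of_mem hj' h3] at h5
          rw [← cls_eq_of_mem hi' h4, cls_eq_of_mem hj' h5]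
          exact self_mem_cls d j
      · rintro ⟨⟨h3, h4⟩, h5⟩
        refine ⟨a, h3, b, h4, ?_, ?_⟩
        · rwa [Ne, C_pow_eq_iff hd hm' hζ ha hb, ← mem_cls]
        · exact (meetsPair_iff_mem_cls hd hm' hζ hu hv hne ha hb ha hb h5 h1 h2).2
            (.inl ⟨self_mem_cls d a, self_mem_cls d b⟩))
  rw [hS, Finset.sum_finset_product _ (nonSelfInv d) (fun a => nonSelfInv d \ cls d a) (by
    intro x
    rw [Finset.mem_filter, Finset.mem_product, Finset.mem_sdiff, and_assoc])]
  have hrow : ∀ a ∈ nonSelfInv d, ∑ b ∈ nonSelfInv d \ cls d a, weight d m' n' a b =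
      ((nonSelfInv d).card - 2) * (m' * n') := by
    intro a ha
    rw [Finset.sum_congr rfl fun b hb => weight_of_notMem (Finset.mem_sdiff.1 hb).2,
      Finset.sum_const, nsmul_eq_mul, Finset.cast_card_sdiff (hcls a ha),
      card_cls_of_ne (mem_nonSelfInv.1 ha).2]
    norm_num
  rw [Finset.sum_congr rfl hrow, Finset.sum_const, nsmul_eq_mul]
  ring

/-- Here all cells are summed; each self-inverse exponent contributes the extra 1 from
`sum_weight_range`. -/
theorem two_mul_ncard_all_lines (hd : 0 < d) (hm' : 0 < m') (hn' : 0 < n')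
    (hcop : m'.Coprime n') (hζ : IsPrimitiveRoot ζ d) :
    2 * ((lines (m' * d) (n' * d)).ncard : ℚ) =
      d * (d * m' * n' - m' - n') + (d - (nonSelfInv d).card) := by
  have hS := two_mul_ncard_lines hd hm' hn' hcop hζ (fun _ => True)
    (Finset.range d ×ˢ Finset.range d) subset_rfl (by
      intro u v _ _ _ a ha b hb _ _
      simp [ha, hb])
  have hall : {L ∈ lines (m' * d) (n' * d) | True} = lines (m' * d) (n' * d) := by simp
  have hcard := Finset.card_filter_add_card_filter_not (s := Finset.range d)
    fun i => negExp d i = i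
  rw [Finset.card_range] at hcard
  have hcard' := congrArg (Nat.cast : ℕ → ℚ) hcard
  push_cast at hcard'
  rw [hall, Finset.sum_product, Finset.sum_congr rfl fun a ha =>
    sum_weight_range (Finset.mem_range.1 ha), Finset.sum_add_distrib, Finset.sum_const,
    Finset.card_range, nsmul_eq_mul, Finset.sum_boole] at hS
  rw [hS, nonSelfInv]
  linarith

end Counting

/-! ### Self-inverse exponents by the parity of d -/

theorem negExp_eq_self_iff {d i : ℕ} (hi : i < d) : negExp d i = i ↔ i = 0 ∨ 2 * i = d := by
  rw [negExp]
  split_ifs <;> omega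

theorem mem_nonSelfInv_of_odd {d i : ℕ} (hd : Odd d) :
    i ∈ nonSelfInv d ↔ 0 < i ∧ i < d := by
  obtain ⟨k, rfl⟩ := hd
  rw [mem_nonSelfInv]
  constructor
  · rintro ⟨h1, h2⟩
    rw [Ne, negExp_eq_self_iff h1] at h2
    omega
  · rintro ⟨h1, h2⟩
    rw [Ne, negExp_eq_self_iff h2]
    omega

theorem mem_nonSelfInv_of_even {d i : ℕ} (hd : Even d) :
    i ∈ nonSelfInv d ↔ 0 < i ∧ i < d ∧ i ≠ d / 2 := by
  obtain ⟨k, rfl⟩ := hd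
  rw [mem_nonSelfInv]
  constructor
  · rintro ⟨h1, h2⟩
    rw [Ne, negExp_eq_self_iff h1] at h2
    omega
  · rintro ⟨h1, h2, h3⟩
    rw [Ne, negExp_eq_self_iff h2]
    omega

theorem card_nonSelfInv_of_odd {d : ℕ} (hd : Odd d) : (nonSelfInv d).card = d - 1 := by
  have : nonSelfInv d = Finset.Ico 1 d := by
    ext i
    rw [mem_nonSelfInv_of_odd hd, Finset.mem_Ico, Nat.succ_le_iff]
  rw [this, Nat.card_Ico]

theorem card_nonSelfInv_of_even {d : ℕ} (hd0 : 0 < d) (hd : Even d) :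
    (nonSelfInv d).card = d - 2 := by
  have : nonSelfInv d = (Finset.Ico 1 d).erase (d / 2) := by
    ext i
    rw [mem_nonSelfInv_of_even hd, Finset.mem_erase, Finset.mem_Ico]
    omega
  obtain ⟨k, rfl⟩ := hd
  rw [this, Finset.card_erase_of_mem (by rw [Finset.mem_Ico]; omega), Nat.card_Ico]
  omega

end TorusCharVar

end

/-! ### Assembly of the theorem -/

open TorusCharVar in
theorem mainTheorem3 (m n d m' n' : ℕ) (hn : 0 < n) (hnm : n ≤ m) (hd : d = Nat.gcd m n)
    (hm' : m = m' * d) (hn' : n = n' * d) (ζ : ℂ) (hζ : IsPrimitiveRoot ζ d) :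
    -- `X(G)` is the union of `V(I₁) ∪ V(I₂)` and `V(I₃)`, and its lines are those of the former
    charVariety m n = (V (I₁ m n) ∪ V (I₂ m n)) ∪ V (I₃ m n) ∧
    {L | IsStraightLine L ∧ L ⊆ charVariety m n} = lines m n ∧
    V (I₁ m n) ∪ V (I₂ m n) = ⋃₀ lines m n ∧
    -- the irreducible components of `V(I₃)` are the `C_{ζ^i}`; two of these are equal or disjoint
    V (I₃ m n) = ⋃ i ∈ Finset.range d, C m' n' (ζ ^ i) ∧
    (∀ i < d, IsIrreducibleAlgebraic (C m' n' (ζ ^ i))) ∧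
    (∀ i < d, ∀ j < d, (C m' n' (ζ ^ i) = C m' n' (ζ ^ j) ↔ i = j ∨ i + j = d) ∧
      (C m' n' (ζ ^ i) ≠ C m' n' (ζ ^ j) →
        Disjoint (C m' n' (ζ ^ i)) (C m' n' (ζ ^ j)))) ∧
    -- every line meets `V(I₃)` in exactly two points
    (∀ L ∈ lines m n, (L ∩ V (I₃ m n)).ncard = 2) ∧
    (lines m n).Finite ∧
    (Odd d →
      -- the number of lines meeting a given component twice, or a given pair of components
      (({L ∈ lines m n | MeetsTwice L (C m' n' 1)}.ncard : ℚ) = (m' - 1) * (n' - 1) / 2) ∧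
      (∀ i, 0 < i → i < d →
        ({L ∈ lines m n | MeetsTwice L (C m' n' (ζ ^ i))}.ncard : ℚ) =
          (m' - 1) * n' + m' * (n' - 1)) ∧
      (∀ i, 0 < i → i < d →
        {L ∈ lines m n | MeetsPair L (C m' n' 1) (C m' n' (ζ ^ i))}.ncard = 2 * m' * n') ∧
      (∀ i j, 0 < i → i < d → 0 < j → j < d → C m' n' (ζ ^ i) ≠ C m' n' (ζ ^ j) →
        {L ∈ lines m n | MeetsPair L (C m' n' (ζ ^ i)) (C m' n' (ζ ^ j))}.ncard =
          4 * m' * n') ∧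
      -- the totals by type
      ({L ∈ lines m n | ∃ i, 0 < i ∧ i < d ∧ MeetsTwice L (C m' n' (ζ ^ i))}.ncard : ℚ) =
        (d - 1) / 2 * ((m' - 1) * n' + m' * (n' - 1)) ∧
      ({L ∈ lines m n | ∃ i, 0 < i ∧ i < d ∧
          MeetsPair L (C m' n' 1) (C m' n' (ζ ^ i))}.ncard : ℚ) =
        (d - 1) / 2 * (2 * m' * n') ∧
      {L ∈ lines m n | ∃ i j, 0 < i ∧ i < d ∧ 0 < j ∧ j < d ∧
          C m' n' (ζ ^ i) ≠ C m' n' (ζ ^ j) ∧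
          MeetsPair L (C m' n' (ζ ^ i)) (C m' n' (ζ ^ j))}.ncard =
        ((d - 1) / 2).choose 2 * (4 * m' * n') ∧
      -- the number of all lines
      ((lines m n).ncard : ℚ) = (m' - 1) * (n' - 1) / 2
        + (d - 1) / 2 * ((m' - 1) * n' + m' * (n' - 1))
        + (d - 1) / 2 * (2 * m' * n')
        + ((d - 1) / 2 : ℕ).choose 2 * (4 * m' * n')) ∧
    (Even d →
      -- the number of lines meeting a given component twice, or a given pair of components
      (({L ∈ lines m n | MeetsTwice L (C m' n' 1)}.ncard : ℚ) = (m' - 1) * (n' - 1) / 2) ∧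
      (({L ∈ lines m n | MeetsTwice L (C m' n' (-1))}.ncard : ℚ) = (m' - 1) * (n' - 1) / 2) ∧
      (∀ i, 0 < i → i < d → i ≠ d / 2 →
        ({L ∈ lines m n | MeetsTwice L (C m' n' (ζ ^ i))}.ncard : ℚ) =
          (m' - 1) * n' + m' * (n' - 1)) ∧
      {L ∈ lines m n | MeetsPair L (C m' n' 1) (C m' n' (-1))}.ncard = m' * n' ∧
      (∀ i, 0 < i → i < d → i ≠ d / 2 →
        {L ∈ lines m n | MeetsPair L (C m' n' 1) (C m' n' (ζ ^ i))}.ncard = 2 * m' * n') ∧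
      (∀ i, 0 < i → i < d → i ≠ d / 2 →
        {L ∈ lines m n | MeetsPair L (C m' n' (-1)) (C m' n' (ζ ^ i))}.ncard = 2 * m' * n') ∧
      (∀ i j, 0 < i → i < d → i ≠ d / 2 → 0 < j → j < d → j ≠ d / 2 →
        C m' n' (ζ ^ i) ≠ C m' n' (ζ ^ j) →
        {L ∈ lines m n | MeetsPair L (C m' n' (ζ ^ i)) (C m' n' (ζ ^ j))}.ncard =
          4 * m' * n') ∧
      -- the totals by type
      ({L ∈ lines m n | ∃ i, 0 < i ∧ i < d ∧ i ≠ d / 2 ∧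
          MeetsTwice L (C m' n' (ζ ^ i))}.ncard : ℚ) =
        (d - 2) / 2 * ((m' - 1) * n' + m' * (n' - 1)) ∧
      ({L ∈ lines m n | ∃ i, 0 < i ∧ i < d ∧ i ≠ d / 2 ∧
          MeetsPair L (C m' n' 1) (C m' n' (ζ ^ i))}.ncard : ℚ) =
        (d - 2) / 2 * (2 * m' * n') ∧
      ({L ∈ lines m n | ∃ i, 0 < i ∧ i < d ∧ i ≠ d / 2 ∧
          MeetsPair L (C m' n' (-1)) (C m' n' (ζ ^ i))}.ncard : ℚ) =
        (d - 2) / 2 * (2 * m' * n') ∧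
      {L ∈ lines m n | ∃ i j, 0 < i ∧ i < d ∧ i ≠ d / 2 ∧ 0 < j ∧ j < d ∧ j ≠ d / 2 ∧
          C m' n' (ζ ^ i) ≠ C m' n' (ζ ^ j) ∧
          MeetsPair L (C m' n' (ζ ^ i)) (C m' n' (ζ ^ j))}.ncard =
        ((d - 2) / 2).choose 2 * (4 * m' * n') ∧
      -- the number of all lines
      ((lines m n).ncard : ℚ) = (m' - 1) * (n' - 1) / 2 + (m' - 1) * (n' - 1) / 2
        + (d - 2) / 2 * ((m' - 1) * n' + m' * (n' - 1))
        + m' * n'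
        + (d - 2) / 2 * (2 * m' * n')
        + (d - 2) / 2 * (2 * m' * n')
        + ((d - 2) / 2 : ℕ).choose 2 * (4 * m' * n')) := by
  subst hm' hn'
  have hd0 : 0 < d := Nat.pos_of_mul_pos_left hn
  have hn'0 : 0 < n' := Nat.pos_of_mul_pos_right hn
  have hm : 0 < m' * d := hn.trans_le hnm
  have hm'0 : 0 < m' := Nat.pos_of_mul_pos_right hm
  have hcop : m'.Coprime n' := by
    rw [Nat.gcd_mul_right] at hd
    exact Nat.eq_of_mul_eq_mul_right hd0 (by rw [one_mul]; exact hd.symm)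
  have hζ0 : ζ ≠ 0 := hζ.ne_zero hd0.ne'
  have hw (i : ℕ) : ζ ^ i ≠ 0 := pow_ne_zero i hζ0
  have hC (i) (hi : i < d) (j) (hj : j < d) :
      C m' n' (ζ ^ i) = C m' n' (ζ ^ j) ↔ i = j ∨ i + j = d := by
    rw [C_pow_eq_iff hd0 hm'0 hζ hi hj, eq_negExp_iff hi hj]
    omega
  have z0 : negExp d 0 = 0 := (negExp_eq_self_iff hd0).2 (.inl rfl)
  refine ⟨charVariety_eq hm hn, straightLines_charVariety_eq hm hn,
    V_I₁_union_V_I₂_eq_sUnion hm hn, V_I₃_eq_iUnion hd0 hζ,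
    fun i _ => isIrreducibleAlgebraic_C hcop hn'0 (hw i),
    fun i hi j hj => ⟨hC i hi j hj, disjoint_C (hw i) (hw j)⟩, ?_, ?_, ?_, ?_⟩
  · rw [lines_eq_image hm hn]
    rintro _ ⟨q, hq, rfl⟩
    exact ncard_lineOf_inter_V_I₃ hm hn hq
  · rw [lines_eq_image hm hn]
    exact (finite_pairs hm hn).image _
  · intro hodd
    have memI (i : ℕ) := mem_nonSelfInv_of_odd (i := i) hodd
    have cardI := card_nonSelfInv_of_odd hodd
    have cardI' : ((nonSelfInv d).card : ℚ) = d - 1 := by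
      rw [cardI, Nat.cast_pred hd0]
    have one_eq : C m' n' 1 = C m' n' (ζ ^ 0) := by rw [pow_zero]
    refine ⟨?_, ?_, ?_, ?_, ?_, ?_, ?_, ?_⟩
    · rw [one_eq]
      exact ncard_meetsTwice_of_eq hd0 hm'0 hn'0 hcop hζ hd0 z0
    · intro i h1 h2
      exact ncard_meetsTwice_of_ne hd0 hm'0 hn'0 hcop hζ ((memI i).2 ⟨h1, h2⟩)
    · intro i h1 h2
      have hi := (mem_nonSelfInv.1 ((memI i).2 ⟨h1, h2⟩)).2
      rw [one_eq, ncard_meetsPair hd0 hm'0 hn'0 hcop hζ hd0 h2 (by simp [cls_of_eq z0, h1.ne']),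
        card_cls_of_eq z0, card_cls_of_ne hi]
    · intro i j h1 h2 h3 h4 hij
      have hi := (mem_nonSelfInv.1 ((memI i).2 ⟨h1, h2⟩)).2
      have hj := (mem_nonSelfInv.1 ((memI j).2 ⟨h3, h4⟩)).2
      rw [Ne, C_pow_eq_iff hd0 hm'0 hζ h2 h4, ← mem_cls] at hij
      rw [ncard_meetsPair hd0 hm'0 hn'0 hcop hζ h2 h4 hij, card_cls_of_ne hi, card_cls_of_ne hj]
    · have := ncard_exists_meetsTwice hd0 hm'0 hn'0 hcop hζ
      simpa only [memI, cardI', and_assoc] using this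
    · have := ncard_exists_meetsPair_of_eq hd0 hm'0 hn'0 hcop hζ hd0 z0
      simpa only [memI, cardI', and_assoc, pow_zero] using this
    · have hset : {L ∈ lines (m' * d) (n' * d) | ∃ i j, 0 < i ∧ i < d ∧ 0 < j ∧ j < d ∧
          C m' n' (ζ ^ i) ≠ C m' n' (ζ ^ j) ∧ MeetsPair L (C m' n' (ζ ^ i)) (C m' n' (ζ ^ j))} =
          {L ∈ lines (m' * d) (n' * d) | ∃ i ∈ nonSelfInv d, ∃ j ∈ nonSelfInv d,
            C m' n' (ζ ^ i) ≠ C m' n' (ζ ^ j) ∧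
              MeetsPair L (C m' n' (ζ ^ i)) (C m' n' (ζ ^ j))} := by
        ext L
        refine and_congr_right fun _ => ⟨?_, ?_⟩
        · rintro ⟨i, j, h1, h2, h3, h4, h⟩
          exact ⟨i, (memI i).2 ⟨h1, h2⟩, j, (memI j).2 ⟨h3, h4⟩, h⟩
        · rintro ⟨i, hi, j, hj, h⟩
          obtain ⟨h1, h2⟩ := (memI i).1 hi
          obtain ⟨h3, h4⟩ := (memI j).1 hj
          exact ⟨i, j, h1, h2, h3, h4, h⟩
      have := two_mul_ncard_exists_meetsPair hd0 hm'0 hn'0 hcop hζ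
      rw [← hset, cardI'] at this
      apply Nat.cast_injective (R := ℚ)
      obtain ⟨k, rfl⟩ := hodd
      -- With d = 2k + 1, the truncated quotient in the binomial is k, and 2k(2k − 2)/2 = 4·(k
      -- choose 2).
      rw [show (2 * k + 1 - 1) / 2 = k by omega]
      push_cast [Nat.cast_choose_two] at this ⊢
      linarith
    -- The total is not added up from the types: it comes from the sum over all cells and agrees
    -- with the stated sum as a polynomial in k, m', n'.
    · have := two_mul_ncard_all_lines hd0 hm'0 hn'0 hcop hζ
      rw [cardI'] at this
      obtain ⟨k, rfl⟩ := hodd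
      rw [show (2 * k + 1 - 1) / 2 = k by omega]
      push_cast [Nat.cast_choose_two] at this ⊢
      linarith
  · intro heven
    have memI (i : ℕ) := mem_nonSelfInv_of_even (i := i) heven
    have hd2 : 2 * (d / 2) = d := Nat.two_mul_div_two_of_even heven
    have cardI := card_nonSelfInv_of_even hd0 heven
    have cardI' : ((nonSelfInv d).card : ℚ) = d - 2 := by
      rw [cardI, Nat.cast_sub (by omega)]
      norm_num
    have one_eq : C m' n' 1 = C m' n' (ζ ^ 0) := by rw [pow_zero]
    have hlt : d / 2 < d := by omega
    have z1 : negExp d (d / 2) = d / 2 := (negExp_eq_self_iff hlt).2 (.inr hd2)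
    -- This power squares to 1 and differs from 1 by primitivity, as 0 < d/2 < d.
    have neg_one : ζ ^ (d / 2) = -1 := by
      have h1 : ζ ^ (d / 2) * ζ ^ (d / 2) = 1 := (pow_mul_pow_eq_one_iff hζ hlt hlt).2 z1.symm
      refine (mul_self_eq_one_iff.1 h1).resolve_left (hζ.pow_ne_one_of_pos_of_lt ?_ hlt)
      omega
    have neg_one_eq : C m' n' (-1) = C m' n' (ζ ^ (d / 2)) := by rw [neg_one]
    refine ⟨?_, ?_, ?_, ?_, ?_, ?_, ?_, ?_, ?_, ?_, ?_, ?_⟩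
    · rw [one_eq]
      exact ncard_meetsTwice_of_eq hd0 hm'0 hn'0 hcop hζ hd0 z0
    · rw [neg_one_eq]
      exact ncard_meetsTwice_of_eq hd0 hm'0 hn'0 hcop hζ hlt z1
    · intro i h1 h2 h3
      exact ncard_meetsTwice_of_ne hd0 hm'0 hn'0 hcop hζ ((memI i).2 ⟨h1, h2, h3⟩)
    · rw [one_eq, neg_one_eq, ncard_meetsPair hd0 hm'0 hn'0 hcop hζ hd0 hlt
        (by rw [cls_of_eq z0, Finset.mem_singleton]; omega), card_cls_of_eq z0, card_cls_of_eq z1]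
      ring
    · intro i h1 h2 h3
      have hi := (mem_nonSelfInv.1 ((memI i).2 ⟨h1, h2, h3⟩)).2
      rw [one_eq, ncard_meetsPair hd0 hm'0 hn'0 hcop hζ hd0 h2 (by simp [cls_of_eq z0, h1.ne']),
        card_cls_of_eq z0, card_cls_of_ne hi]
    · intro i h1 h2 h3
      have hi := (mem_nonSelfInv.1 ((memI i).2 ⟨h1, h2, h3⟩)).2
      rw [neg_one_eq, ncard_meetsPair hd0 hm'0 hn'0 hcop hζ hlt h2 (by simp [cls_of_eq z1, h3]),
        card_cls_of_eq z1, card_cls_of_ne hi]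
    · intro i j h1 h2 h2' h3 h4 h4' hij
      have hi := (mem_nonSelfInv.1 ((memI i).2 ⟨h1, h2, h2'⟩)).2
      have hj := (mem_nonSelfInv.1 ((memI j).2 ⟨h3, h4, h4'⟩)).2
      rw [Ne, C_pow_eq_iff hd0 hm'0 hζ h2 h4, ← mem_cls] at hij
      rw [ncard_meetsPair hd0 hm'0 hn'0 hcop hζ h2 h4 hij, card_cls_of_ne hi, card_cls_of_ne hj]
    · have := ncard_exists_meetsTwice hd0 hm'0 hn'0 hcop hζ
      simpa only [memI, cardI', and_assoc] using this
    · have := ncard_exists_meetsPair_of_eq hd0 hm'0 hn'0 hcop hζ hd0 z0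
      simpa only [memI, cardI', and_assoc, pow_zero] using this
    · have := ncard_exists_meetsPair_of_eq hd0 hm'0 hn'0 hcop hζ hlt z1
      simpa only [memI, cardI', and_assoc, neg_one] using this
    · have hset : {L ∈ lines (m' * d) (n' * d) |
          ∃ i j, 0 < i ∧ i < d ∧ i ≠ d / 2 ∧ 0 < j ∧ j < d ∧ j ≠ d / 2 ∧
          C m' n' (ζ ^ i) ≠ C m' n' (ζ ^ j) ∧ MeetsPair L (C m' n' (ζ ^ i)) (C m' n' (ζ ^ j))} =
          {L ∈ lines (m' * d) (n' * d) | ∃ i ∈ nonSelfInv d, ∃ j ∈ nonSelfInv d,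
            C m' n' (ζ ^ i) ≠ C m' n' (ζ ^ j) ∧
              MeetsPair L (C m' n' (ζ ^ i)) (C m' n' (ζ ^ j))} := by
        ext L
        refine and_congr_right fun _ => ⟨?_, ?_⟩
        · rintro ⟨i, j, h1, h2, h3, h4, h5, h6, h⟩
          exact ⟨i, (memI i).2 ⟨h1, h2, h3⟩, j, (memI j).2 ⟨h4, h5, h6⟩, h⟩
        · rintro ⟨i, hi, j, hj, h⟩
          obtain ⟨h1, h2, h3⟩ := (memI i).1 hi
          obtain ⟨h4, h5, h6⟩ := (memI j).1 hj
          exact ⟨i, j, h1, h2, h3, h4, h5, h6, h⟩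
      have := two_mul_ncard_exists_meetsPair hd0 hm'0 hn'0 hcop hζ
      rw [← hset, cardI'] at this
      apply Nat.cast_injective (R := ℚ)
      obtain ⟨k, rfl⟩ := heven
      -- Writing d = 2(l + 1) makes (d − 2)/2 = l without truncated subtraction.
      obtain ⟨l, rfl⟩ : ∃ l, k = l + 1 := ⟨k - 1, by omega⟩
      rw [show (l + 1 + (l + 1) - 2) / 2 = l by omega]
      push_cast [Nat.cast_choose_two] at this ⊢
      linarith
    · have := two_mul_ncard_all_lines hd0 hm'0 hn'0 hcop hζ
      rw [cardI'] at this
      obtain ⟨k, rfl⟩ := heven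
      obtain ⟨l, rfl⟩ : ∃ l, k = l + 1 := ⟨k - 1, by omega⟩
      rw [show (l + 1 + (l + 1) - 2) / 2 = l by omega]
      push_cast [Nat.cast_choose_two] at this ⊢
      linarith
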